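/- An edge-coloring (not necessarily proper) of a connected graph $G$ is a conflict-free connection coloring if every two distinct vertices are joined by a path on which some color appears on exactly one edge. The conflict-free connection number $\mathrm{cfc}(G)$ is the smallest number of colors in such a coloring. Graphs are finite and simple, equalities of graphs are up to isomorphism, $\Delta(G)$ is the maximum degree, $K_n$ is the complete graph on $n$ vertices, $P_n$ the path and $C_n$ the cycle on $n$ vertices. $K_{1,n-1}+e$ is the star with $n-1$ leaves plus an edge joining two leaves. For $n\ge 5$, $U_n$ is obtained from the tree of order $n$ and diameter $3$ whose two non-leaf vertices $a,b$ have degrees $3$ and $n-3$ by adding an edge joining the two leaves adjacent to $a$. **Theorem.** Let $G$ be a connected graph of order $n\ge 4$. Then $\mathrm{cfc}(G)=n-3$ if and only if one of the following holds: (i) $n\ge 6$ and $G$ is a tree with $\Delta(G)=n-3$; (ii) $n\ge 5$ and $G=K_{1,n-1}+e$; (iii) $n\ge 5$ and $G=U_n$; (iv) $G$ is a $2$-edge-connected non-complete graph of order $5$; (v) $G\in\{K_4,P_6,G_1,\dots,G_6\}$, where $G_1$ is the bull (a triangle with one pendant edge attached at each of two of its vertices); $G_2$ is $C_4$ with one pendant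 edge attached; $G_3$ and $G_4$ are the graph $K_4$ minus an edge with one pendant edge attached at a vertex of degree $3$, respectively at a vertex of degree $2$; $G_5$ is $K_4$ with one pendant edge attached; and $G_6$ is the tree of order $7$ obtained from a path on three vertices by attaching two pendant edges at each of its two end vertices. -/

import Mathlib

namespace CFC

open SimpleGraph

universe u

variable {V : Type u} {G : SimpleGraph V} {K : Type*}

/-- Some color is used by the edge-coloring `c` on exactly one of the edges of the walk `p`.
A conflict-free path is a walk that is a path and has this property. -/
def ConflictFree (c : G.EdgeLabeling K) {x y : V} (p : G.Walk x y) : Prop :=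
  ∃ a : K, ∃! e : G.edgeSet, (e : Sym2 V) ∈ p.edges ∧ c e = a

/-- The edge-coloring `c` (not necessarily proper) is a conflict-free connection coloring:
any two distinct vertices are joined by a conflict-free path. -/
def IsConflictFreeConnection (c : G.EdgeLabeling K) : Prop :=
  ∀ x y : V, x ≠ y → ∃ p : G.Walk x y, p.IsPath ∧ ConflictFree c p

/-- The conflict-free connection number: the least number of colors in a conflict-free
connection coloring. (For a finite connected graph one exists: color the edges injectively.) -/
noncomputable def cfc (G : SimpleGraph V) : ℕ :=
  sInf {k : ℕ | ∃ c : G.EdgeLabeling (Fin k), IsConflictFreeConnection c}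

/-- `G` is `K_{1,n-1} + e`: a star on the whole vertex set, with centre `r`, together with
one edge joining two leaves. -/
def IsStarAddEdge (G : SimpleGraph V) : Prop :=
  ∃ r x y : V, x ≠ r ∧ y ≠ r ∧ x ≠ y ∧ G = starGraph r ⊔ edge x y

/-- For distinct `a, b, x, y`, this is the double star `S_{3,n-3}` on the whole vertex set:
its non-leaves are `a` (of degree `3`, with leaf neighbours `x`, `y`) and `b` (adjacent to `a` and
to all the remaining vertices). -/
def doubleStar (a b x y : V) : SimpleGraph V :=
  fromRel fun u v => (u = a ∧ (v = x ∨ v = y)) ∨ (u = b ∧ v ≠ x ∧ v ≠ y)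

/-- `G` is `U_n`: the double star `S_{3,n-3}` (with `n - 3 ≥ 2`, so at least five vertices)
together with the edge joining the two leaves adjacent to the vertex of degree `3`. -/
def IsU (G : SimpleGraph V) : Prop :=
  ∃ a b x y z : V, [a, b, x, y, z].Nodup ∧ G = doubleStar a b x y ⊔ edge x y

/-- The bull: a triangle with pendant edges at two of its vertices. -/
def bull : SimpleGraph (Fin 5) :=
  fromEdgeSet {s(0, 1), s(1, 2), s(0, 2), s(0, 3), s(1, 4)}

/-- The 4-cycle `0 1 2 3` with a pendant edge. -/
def cyclePendant : SimpleGraph (Fin 5) :=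
  fromEdgeSet {s(0, 1), s(1, 2), s(2, 3), s(0, 3), s(0, 4)}

/-- `K₄` minus an edge, with a pendant edge at a vertex of degree 3. -/
def diamondPendantThree : SimpleGraph (Fin 5) :=
  fromEdgeSet {s(0, 1), s(1, 2), s(2, 3), s(0, 3), s(0, 2), s(0, 4)}

/-- `K₄` minus an edge, with a pendant edge at a vertex of degree 2. -/
def diamondPendantTwo : SimpleGraph (Fin 5) :=
  fromEdgeSet {s(0, 1), s(1, 2), s(2, 3), s(0, 3), s(1, 3), s(0, 4)}

/-- `K₄` with a pendant edge. -/
def completePendant : SimpleGraph (Fin 5) :=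
  fromEdgeSet {s(0, 1), s(1, 2), s(2, 3), s(0, 3), s(0, 2), s(1, 3), s(0, 4)}

/-- The tree of order 7 formed by a path `1 0 2` with two pendant edges at each of its ends. -/
def forkedTree : SimpleGraph (Fin 7) :=
  fromEdgeSet {s(0, 1), s(0, 2), s(1, 3), s(1, 4), s(2, 5), s(2, 6)}

end CFC

namespace CFC

open SimpleGraph

universe u

variable {V : Type u} {G : SimpleGraph V} {K : Type*}

/-! Upper bounds come from small subgraphs. Suppose `k` colors serve a vertex set `S` by paths
inside `S`. A vertex adjacent to `S` can then be added at the price of one color, since the color of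
the new edge is unique on every path ending with that edge (`ColorableOn.extend`). So a subgraph of
order `m` with `k` colors gives `cfc G ≤ n - (m - k)` (`ColorableOn.cfc_add_card_le`), and `cfc G ≤
n - 4` follows from a small subgraph that saves four: the pairs `(m, k)` used are `(6, 2)`, `(7, 3)`
and `(8, 4)`. That the explicit colorings work is a finite search run by the kernel.

Lower bounds come from forced paths. Two bridges at a vertex form the only path between their far
ends, so bridges at a vertex have distinct colors (`card_le_cfc_of_isBridge`). In a forest no path
of four edges is colored alternately. One color suffices only for complete graphs.

Order at least six, with a cycle: a cycle of length at least four leads to a saving of four. So does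
a triangle with three more vertices, unless three bridges of this small graph share a vertex. The
two exceptional shapes, in a graph where nothing saves four, force `K_{1,n-1} + e` and `U_n`.

Trees: the maximum degree is at most `cfc G`. If it is at most two, the tree is a path. If it lies
between `3` and `n - 4`, three vertices beyond the closed neighborhood of a vertex of maximum degree
complete a seven-vertex tree that three colors serve, with two exceptions; pursuing these leaves
only the forked tree.

Order five, with a cycle: `cfc G = 2` unless `G` is complete, and the graphs that are not
2-edge-connected are enumerated through a cut of at most one edge. In order four, `cfc G = 1` means
`K₄`. -/

/-- The vertices of `S` are pairwise joined, inside `S`, by conflict-free paths of an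
edge-coloring with `k` colors. -/
def ColorableOn (G : SimpleGraph V) (S : Finset V) (k : ℕ) : Prop :=
  ∃ c : Sym2 V → ℕ, (∀ e, c e < k) ∧ ∀ x ∈ S, ∀ y ∈ S, x ≠ y → ∃ p : G.Walk x y,
    p.IsPath ∧ (∀ v ∈ p.support, v ∈ S) ∧ ∃ a, (p.edges.map c).count a = 1

/-! ### Growing a colored vertex set one vertex at a time -/

lemma conflictFree_of_count {k : ℕ} {c : Sym2 V → ℕ} (hc : ∀ e, c e < k) {x y : V}
    {p : G.Walk x y} {a : ℕ} (h : (p.edges.map c).count a = 1) :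
    ConflictFree (fun e : G.edgeSet ↦ (⟨c e, hc e⟩ : Fin k)) p := by
  rw [List.count_eq_countP, List.countP_map, List.countP_eq_length_filter,
    List.length_eq_one_iff] at h
  obtain ⟨e, he⟩ := h
  have hm : ∀ e', e' ∈ p.edges ∧ c e' = a ↔ e' = e := fun e' ↦ by
    have : e' ∈ p.edges.filter ((fun b ↦ b == a) ∘ c) ↔ e' = e := by rw [he]; simp
    simpa using this
  have hme := (hm e).2 rfl
  refine ⟨⟨a, hme.2 ▸ hc e⟩, ⟨e, p.edges_subset_edgeSet hme.1⟩, ⟨hme.1, Fin.ext hme.2⟩, ?_⟩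
  rintro ⟨e', he'⟩ ⟨h1, h2⟩
  exact Subtype.ext ((hm e').1 ⟨h1, congrArg Fin.val h2⟩)

lemma _root_.SimpleGraph.Connected.exists_adj_boundary (hG : G.Connected) {S : Set V} {x y : V}
    (hx : x ∈ S) (hy : y ∉ S) : ∃ u ∈ S, ∃ v ∉ S, G.Adj u v := by
  obtain ⟨p⟩ := hG x y
  obtain ⟨d, -, h1, h2⟩ := p.exists_boundary_dart S hx hy
  exact ⟨d.fst, h1, d.snd, h2, d.adj⟩

lemma ColorableOn.extend [DecidableEq V] {S : Finset V} {k : ℕ} (h : ColorableOn G S k) {u v : V}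
    (hu : u ∈ S) (hv : v ∉ S) (huv : G.Adj u v) : ColorableOn G (insert v S) (k + 1) := by
  classical
  obtain ⟨c, hc, h⟩ := h
  -- All edges at `v` receive the new color `k`. Paths inside `S` avoid `v`, and each new path uses
  -- only `uv` among these edges, so `k` occurs on it once.
  let c' : Sym2 V → ℕ := fun e ↦ if v ∈ e then k else c e
  have hcc {x y : V} (p : G.Walk x y) (hp : ∀ w ∈ p.support, w ∈ S) :
      p.edges.map c' = p.edges.map c := List.map_congr_left fun e he ↦ by
    have : v ∉ e := fun hve ↦ hv (hp v (p.mem_support_of_mem_edges he hve))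
    simp [c', this]
  have key (x : V) (hx : x ∈ S) : ∃ p : G.Walk x v, p.IsPath ∧
      (∀ w ∈ p.support, w ∈ insert v S) ∧ ∃ a, (p.edges.map c').count a = 1 := by
    have : ∃ p : G.Walk x u, p.IsPath ∧ ∀ w ∈ p.support, w ∈ S := by
      by_cases hxu : x = u
      · subst hxu
        exact ⟨.nil, by simp, by simpa using hx⟩
      · obtain ⟨p, hp, hs, -⟩ := h x hx u hu hxu
        exact ⟨p, hp, hs⟩
    obtain ⟨p, hp, hs⟩ := this
    refine ⟨p.concat huv, hp.concat (fun hvp ↦ hv (hs v hvp)) huv, ?_, k, ?_⟩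
    · intro w hw
      rw [Walk.support_concat, List.mem_append] at hw
      rcases hw with hw | hw
      · exact Finset.mem_insert_of_mem (hs w hw)
      · simp_all
    · rw [Walk.edges_concat, List.concat_eq_append, List.map_append, hcc p hs, List.count_append,
        List.count_eq_zero_of_not_mem]
      · simp [c']
      · intro hk
        obtain ⟨e, -, he⟩ := List.mem_map.1 hk
        exact (hc e).ne he
  refine ⟨c', fun e ↦ ?_, fun x hx y hy hxy ↦ ?_⟩
  · by_cases hve : v ∈ e
    · simp [c', hve]
    · simpa [c', hve] using (hc e).trans (Nat.lt_succ_self k)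
  · rcases Finset.mem_insert.1 hx with hx | hx' <;> rcases Finset.mem_insert.1 hy with hy | hy'
    · exact absurd (hx.trans hy.symm) hxy
    · subst hx
      obtain ⟨p, hp, hs, a, ha⟩ := key y hy'
      exact ⟨p.reverse, hp.reverse, by simpa using hs, a, by simpa using ha⟩
    · subst hy
      exact key x hx'
    · obtain ⟨p, hp, hs, a, ha⟩ := h x hx' y hy' hxy
      exact ⟨p, hp, fun w hw ↦ Finset.mem_insert_of_mem (hs w hw), a, by rwa [hcc p hs]⟩

/-- Connectedness always supplies an edge leaving `S`, and each extension raises both `k` and the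
cardinality of `S` by one, so their difference is preserved until `S` is everything. -/
lemma ColorableOn.cfc_add_card_le [Fintype V] (hG : G.Connected) {S : Finset V} {k : ℕ}
    (h : ColorableOn G S k) (hS : S.Nonempty) : cfc G + S.card ≤ k + Fintype.card V := by
  classical
  by_cases hu : S = Finset.univ
  · subst hu
    obtain ⟨c, hc, h⟩ := h
    rw [Finset.card_univ]
    refine Nat.add_le_add_right (Nat.sInf_le (m := k) ?_) _
    refine ⟨fun e ↦ ⟨c e, hc e⟩, fun x y hxy ↦ ?_⟩
    obtain ⟨p, hp, -, a, ha⟩ := h x (Finset.mem_univ x) y (Finset.mem_univ y) hxy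
    exact ⟨p, hp, conflictFree_of_count hc ha⟩
  · obtain ⟨x, hx⟩ := hS
    obtain ⟨y, hy⟩ : ∃ y, y ∉ S := by
      by_contra! hall
      exact hu (Finset.eq_univ_iff_forall.2 hall)
    obtain ⟨u, hu', v, hv, huv⟩ := hG.exists_adj_boundary (S := S) hx hy
    have hv' : v ∉ S := hv
    have hcard := Finset.card_insert_of_notMem hv'
    have hlt : (insert v S).card ≤ Fintype.card V := Finset.card_le_univ _
    have := (h.extend hu' hv' huv).cfc_add_card_le hG (Finset.insert_nonempty v S)
    omega
termination_by Fintype.card V - S.card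

/-- The infimum of an empty set of naturals is `0`, so some coloring must be exhibited before `cfc`
means anything; one grows from a single vertex. -/
lemma exists_isConflictFreeConnection [Fintype V] (hG : G.Connected) :
    ∃ c : G.EdgeLabeling (Fin (cfc G)), IsConflictFreeConnection c := by
  classical
  refine Nat.sInf_mem (s := {k : ℕ | ∃ c : G.EdgeLabeling (Fin k), IsConflictFreeConnection c}) ?_
  have key : ∀ m, ∀ S : Finset V, S.Nonempty → (∃ k, ColorableOn G S k) →
      Fintype.card V = S.card + m → ∃ k, ColorableOn G Finset.univ k := by
    intro m
    induction m with
    | zero =>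
      intro S _ h hc
      rwa [S.card_eq_iff_eq_univ.1 (by omega)] at h
    | succ m ih =>
      rintro S ⟨x, hx⟩ ⟨k, hk⟩ hc
      obtain ⟨y, hy⟩ : ∃ y, y ∉ S := by
        by_contra! hall
        rw [Finset.eq_univ_iff_forall.2 hall, Finset.card_univ] at hc
        omega
      obtain ⟨u, hu', v, hv, huv⟩ := hG.exists_adj_boundary (S := S) hx hy
      have hv' : v ∉ S := hv
      refine ih (insert v S) (Finset.insert_nonempty v S) ⟨_, hk.extend hu' hv' huv⟩ ?_
      rw [Finset.card_insert_of_notMem hv']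
      omega
  obtain ⟨x⟩ := hG.nonempty
  obtain ⟨k, c, hc, h⟩ := key (Fintype.card V - 1) {x} (Finset.singleton_nonempty x)
    ⟨1, fun _ ↦ 0, by simp, by simp +contextual⟩ (by
      have : 0 < Fintype.card V := Fintype.card_pos_iff.2 ⟨x⟩
      simp; omega)
  refine ⟨k, fun e ↦ ⟨c e, hc e⟩, fun x y hxy ↦ ?_⟩
  obtain ⟨p, hp, -, a, ha⟩ := h x (Finset.mem_univ x) y (Finset.mem_univ y) hxy
  exact ⟨p, hp, conflictFree_of_count hc ha⟩

lemma exists_coloring_of_cfc_le [Fintype V] (hG : G.Connected) {k : ℕ} (hk : cfc G ≤ k) :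
    ∃ c : G.EdgeLabeling (Fin k), IsConflictFreeConnection c := by
  obtain ⟨c, hc⟩ := exists_isConflictFreeConnection hG
  refine ⟨fun e ↦ Fin.castLE hk (c e), fun x y hxy ↦ ?_⟩
  obtain ⟨p, hp, a, e, he, hu⟩ := hc x y hxy
  exact ⟨p, hp, Fin.castLE hk a, e, ⟨he.1, congrArg _ he.2⟩,
    fun e' h' ↦ hu e' ⟨h'.1, Fin.castLE_injective hk h'.2⟩⟩

/-! ### Subgraphs given by lists of edges -/

/-- `f` maps `0, …, m - 1` injectively to vertices of `G` and the pairs in `E` to edges of `G`. -/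
structure Embeds (G : SimpleGraph V) (E : List (ℕ × ℕ)) (m : ℕ) (f : ℕ → V) : Prop where
  inj : Set.InjOn f (Set.Iio m)
  adj : ∀ e ∈ E, e.1 < m ∧ e.2 < m ∧ G.Adj (f e.1) (f e.2)

/-- Some number occurs exactly once in the list. -/
def hasUnique (l : List ℕ) : Bool := l.any fun a ↦ l.count a == 1

/-- Depth-first search, from `x` to `t` in a graph with colored edges, for a path with a unique
color that avoids the visited vertices `vis` and continues a path whose list of colors is `cs`. -/
def search (E : List ((ℕ × ℕ) × ℕ)) (t : ℕ) : ℕ → List ℕ → ℕ → List ℕ → Bool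
  | 0, _, _, _ => false
  | n + 1, vis, x, cs =>
    (x == t && hasUnique cs) || E.any fun e ↦
      (e.1.1 == x && !vis.contains e.1.2 && search E t n (e.1.2 :: vis) e.1.2 (e.2 :: cs)) ||
      (e.1.2 == x && !vis.contains e.1.1 && search E t n (e.1.1 :: vis) e.1.1 (e.2 :: cs))

/-- No pair occurs twice in the list, in either orientation. -/
def distinctEdges : List ((ℕ × ℕ) × ℕ) → Bool
  | [] => true
  | e :: E => E.all (fun d ↦ !(d.1.1 == e.1.1 && d.1.2 == e.1.2) &&
      !(d.1.1 == e.1.2 && d.1.2 == e.1.1)) && distinctEdges E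

/-- The colored edges `E` give a conflict-free connection coloring with `k` colors of the graph
with vertices `0, …, m - 1`. -/
def isConflictFree (E : List ((ℕ × ℕ) × ℕ)) (m k : ℕ) : Bool :=
  distinctEdges E && E.all (fun e ↦ e.2 < k) &&
    (List.range m).all fun x ↦ (List.range x).all fun y ↦ search E y m [x] x []

/-- One of the words in `W` colors the edges `E` so that `isConflictFree` holds. -/
def colorable (E : List (ℕ × ℕ)) (m k : ℕ) (W : List (List ℕ)) : Bool :=
  W.any fun w ↦ isConflictFree (E.zip w) m k

/-- Invariant of the search: some path ends at the current vertex, has support the image of `vis`,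
and has colors `cs` up to order (the search prepends, the path appends). Only soundness is needed:
running out of fuel returns `false`. -/
lemma search_sound [DecidableEq V] {E : List ((ℕ × ℕ) × ℕ)} {m : ℕ} {f : ℕ → V} {c : Sym2 V → ℕ}
    (hf : Set.InjOn f (Set.Iio m))
    (hE : ∀ e ∈ E, e.1.1 < m ∧ e.1.2 < m ∧ G.Adj (f e.1.1) (f e.1.2) ∧
      c s(f e.1.1, f e.1.2) = e.2) {x₀ t : ℕ} (n : ℕ) :
    ∀ (vis : List ℕ) (x : ℕ) (cs : List ℕ) (p : G.Walk (f x₀) (f x)), p.IsPath →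
      (∀ i ∈ vis, i < m) → (∀ v, v ∈ p.support ↔ ∃ i ∈ vis, f i = v) →
      (p.edges.map c).Perm cs → search E t n vis x cs = true →
      ∃ p : G.Walk (f x₀) (f t), p.IsPath ∧ (∀ v ∈ p.support, v ∈ (Finset.range m).image f) ∧
        ∃ a, (p.edges.map c).count a = 1 := by
  induction n with
  | zero => intro vis x cs p _ _ _ _ h; simp [search] at h
  | succ n ih =>
    intro vis x cs p hp hvis hs hcs h
    have step {y a : ℕ} (hy : y < m) (hyv : y ∉ vis) (hadj : G.Adj (f x) (f y))
        (hc : c s(f x, f y) = a) (h : search E t n (y :: vis) y (a :: cs) = true) :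
        ∃ p : G.Walk (f x₀) (f t), p.IsPath ∧
          (∀ v ∈ p.support, v ∈ (Finset.range m).image f) ∧
          ∃ a, (p.edges.map c).count a = 1 := by
      refine ih (y :: vis) y (a :: cs) (p.concat hadj) (hp.concat ?_ hadj) ?_ ?_ ?_ h
      · intro hyp
        obtain ⟨i, hi, hiy⟩ := (hs _).1 hyp
        exact hyv (hf (hvis i hi) hy hiy ▸ hi)
      · simpa using ⟨hy, hvis⟩
      · intro v
        rw [Walk.support_concat, List.mem_append, hs]
        simp [or_comm, eq_comm]
      · rw [Walk.edges_concat, List.concat_eq_append, List.map_append]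
        refine List.perm_append_comm.trans ?_
        simpa [hc] using hcs
    simp only [search, Bool.or_eq_true, Bool.and_eq_true, beq_iff_eq, List.any_eq_true,
      Bool.not_eq_true', List.contains_eq_mem, decide_eq_false_iff_not] at h
    rcases h with ⟨rfl, hu⟩ | ⟨e, he, ⟨⟨rfl, hv⟩, h⟩ | ⟨⟨rfl, hv⟩, h⟩⟩
    · simp only [hasUnique, List.any_eq_true, beq_iff_eq] at hu
      obtain ⟨a, -, ha⟩ := hu
      refine ⟨p, hp, fun v hv ↦ ?_, a, by rw [hcs.count_eq, ha]⟩
      obtain ⟨i, hi, rfl⟩ := (hs v).1 hv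
      exact Finset.mem_image_of_mem f (Finset.mem_range.2 (hvis i hi))
    · obtain ⟨-, h2, h3, h4⟩ := hE e he
      exact step h2 hv h3 h4 h
    · obtain ⟨h1, -, h3, h4⟩ := hE e he
      exact step h1 hv h3.symm (by rw [Sym2.eq_swap, h4]) h

/-- Prescribed colors cannot clash, because the listed pairs differ even as unordered pairs and `f`
is injective. All other pairs get the default color `0`, which is why `0 < k` is required. -/
lemma exists_coloring_of_distinctEdges {m k : ℕ} (hk : 0 < k) {f : ℕ → V}
    (hf : Set.InjOn f (Set.Iio m)) (E : List ((ℕ × ℕ) × ℕ)) (hd : distinctEdges E = true)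
    (hE : ∀ e ∈ E, e.1.1 < m ∧ e.1.2 < m) (hkE : ∀ e ∈ E, e.2 < k) :
    ∃ c : Sym2 V → ℕ, (∀ e, c e < k) ∧ ∀ e ∈ E, c s(f e.1.1, f e.1.2) = e.2 := by
  classical
  induction E with
  | nil => exact ⟨fun _ ↦ 0, fun _ ↦ hk, by simp⟩
  | cons e E ih =>
    simp only [distinctEdges, Bool.and_eq_true, List.all_eq_true, Bool.not_eq_true',
      Bool.and_eq_false_iff, beq_eq_false_iff_ne] at hd
    obtain ⟨c, hc, h⟩ := ih hd.2 (fun e he ↦ hE e (List.mem_cons_of_mem _ he))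
      (fun e he ↦ hkE e (List.mem_cons_of_mem _ he))
    refine ⟨Function.update c s(f e.1.1, f e.1.2) e.2, fun d ↦ ?_, fun d hd' ↦ ?_⟩
    · rw [Function.update_apply]
      split_ifs
      · exact hkE e List.mem_cons_self
      · exact hc d
    · rcases List.mem_cons.1 hd' with rfl | hd'
      · simp
      · rw [Function.update_of_ne, h d hd']
        have he := hE e List.mem_cons_self
        have hde := hE d (List.mem_cons_of_mem _ hd')
        have := hd.1 d hd'
        rw [Ne, Sym2.eq_iff, hf.eq_iff hde.1 he.1, hf.eq_iff hde.2 he.2, hf.eq_iff hde.1 he.2,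
          hf.eq_iff hde.2 he.1]
        tauto

lemma Embeds.colorableOn [DecidableEq V] {E : List (ℕ × ℕ)} {m k : ℕ} {f : ℕ → V}
    (h : Embeds G E m f) (hk : 0 < k) {W : List (List ℕ)} (hc : colorable E m k W = true) :
    ColorableOn G ((Finset.range m).image f) k := by
  obtain ⟨w, -, hw⟩ := List.any_eq_true.1 hc
  simp only [isConflictFree, Bool.and_eq_true, List.all_eq_true, decide_eq_true_eq,
    List.mem_range] at hw
  obtain ⟨⟨hd, hkE⟩, hw⟩ := hw
  have hE : ∀ e ∈ E.zip w, e.1.1 < m ∧ e.1.2 < m ∧ G.Adj (f e.1.1) (f e.1.2) :=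
    fun e he ↦ h.adj e.1 (List.of_mem_zip (a := e.1) (b := e.2) he).1
  obtain ⟨c, hck, hcE⟩ := exists_coloring_of_distinctEdges hk h.inj _ hd
    (fun e he ↦ ⟨(hE e he).1, (hE e he).2.1⟩) hkE
  have key {x y : ℕ} (hx : x < m) (hxy : y < x) : ∃ p : G.Walk (f x) (f y), p.IsPath ∧
      (∀ v ∈ p.support, v ∈ (Finset.range m).image f) ∧ ∃ a, (p.edges.map c).count a = 1 :=
    search_sound h.inj (fun e he ↦ ⟨(hE e he).1, (hE e he).2.1, (hE e he).2.2, hcE e he⟩) m [x] x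
      [] .nil (by simp) (by simpa using hx) (by simp [eq_comm]) (by simp) (hw x hx y hxy)
  refine ⟨c, hck, fun u hu v hv huv ↦ ?_⟩
  obtain ⟨x, hx, rfl⟩ := Finset.mem_image.1 hu
  obtain ⟨y, hy, rfl⟩ := Finset.mem_image.1 hv
  rw [Finset.mem_range] at hx hy
  rcases lt_trichotomy x y with hxy | rfl | hxy
  · obtain ⟨p, hp, hs, a, ha⟩ := key hy hxy
    exact ⟨p.reverse, hp.reverse, by simpa using hs, a, by simpa using ha⟩
  · exact absurd rfl huv
  · exact key hx hxy

lemma Embeds.card_le [Fintype V] {E : List (ℕ × ℕ)} {m : ℕ} {f : ℕ → V} (h : Embeds G E m f) :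
    m ≤ Fintype.card V := by
  classical
  have : ((Finset.range m).image f).card = m := by
    rw [Finset.card_image_of_injOn (by simpa [Set.Iio_def] using h.inj), Finset.card_range]
  exact this ▸ Finset.card_le_univ _

/-- If the connected graph `G` has a subgraph of order `m` with a conflict-free connection
coloring in `k` colors, then `cfc G ≤ k + (n - m)`. -/
lemma Embeds.cfc_add_le [Fintype V] (hG : G.Connected) {E : List (ℕ × ℕ)} {m k : ℕ} {f : ℕ → V}
    (h : Embeds G E m f) (W : List (List ℕ)) (hc : colorable E m k W = true)
    (hm : 0 < m := by norm_num) (hk : 0 < k := by norm_num) :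
    cfc G + m ≤ k + Fintype.card V := by
  classical
  have := (h.colorableOn hk hc).cfc_add_card_le hG ⟨f 0, Finset.mem_image_of_mem f (by simpa)⟩
  rwa [Finset.card_image_of_injOn (by simpa [Set.Iio_def] using h.inj), Finset.card_range] at this

/-- The new edge goes to the front of the list, so in the color words the last attached vertex comes
first. -/
lemma Embeds.cons {E : List (ℕ × ℕ)} {m : ℕ} {f : ℕ → V} (h : Embeds G E m f) {i : ℕ} {v : V}
    (hi : i < m) (hv : ∀ j < m, f j ≠ v) (hiv : G.Adj (f i) v) :
    Embeds G ((i, m) :: E) (m + 1) (Function.update f m v) := by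
  have hlt {j : ℕ} (hj : j < m) : Function.update f m v j = f j :=
    Function.update_of_ne hj.ne _ _
  refine ⟨fun a ha b hb hab ↦ ?_, fun e he ↦ ?_⟩
  · rcases (Nat.lt_succ_iff_lt_or_eq.1 ha) with ha | rfl <;>
      rcases (Nat.lt_succ_iff_lt_or_eq.1 hb) with hb | rfl
    · rw [hlt ha, hlt hb] at hab
      exact h.inj ha hb hab
    · simp [hlt ha, hv a ha] at hab
    · rw [Function.update_self, hlt hb] at hab
      exact absurd hab.symm (hv b hb)
    · rfl
  · rcases List.mem_cons.1 he with rfl | he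
    · exact ⟨hi.trans m.lt_succ_self, m.lt_succ_self, by simpa [hlt hi] using hiv⟩
    · obtain ⟨h1, h2, h3⟩ := h.adj e he
      rw [hlt h1, hlt h2]
      exact ⟨h1.trans m.lt_succ_self, h2.trans m.lt_succ_self, h3⟩

lemma Embeds.exists_cons [Fintype V] (hG : G.Connected) {E : List (ℕ × ℕ)} {m : ℕ} {f : ℕ → V}
    (h : Embeds G E m f) (hm : 0 < m) (hn : m < Fintype.card V) :
    ∃ i < m, ∃ v, Embeds G ((i, m) :: E) (m + 1) (Function.update f m v) := by
  classical
  obtain ⟨y, hy⟩ : ∃ y, y ∉ f '' Set.Iio m := by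
    by_contra! hall
    have : (Finset.range m).image f = Finset.univ := by
      ext v
      simpa using hall v
    have h2 := Finset.card_image_le (s := Finset.range m) (f := f)
    rw [this, Finset.card_univ, Finset.card_range] at h2
    omega
  obtain ⟨u, ⟨i, hi, rfl⟩, v, hv, huv⟩ :=
    hG.exists_adj_boundary (Set.mem_image_of_mem f (Set.mem_Iio.2 hm)) hy
  exact ⟨i, hi, v, h.cons hi (fun j hj hjv ↦ hv ⟨j, hj, hjv⟩) huv⟩

lemma embeds_of_list {E : List (ℕ × ℕ)} {l : List V} (d : V) (hl : l.Nodup)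
    (hE : ∀ e ∈ E, e.1 < l.length ∧ e.2 < l.length ∧ G.Adj (l.getD e.1 d) (l.getD e.2 d)) :
    Embeds G E l.length (l.getD · d) where
  inj a ha b hb hab := by
    simp only [List.getD_eq_getElem _ _ (Set.mem_Iio.1 ha),
      List.getD_eq_getElem _ _ (Set.mem_Iio.1 hb)] at hab
    exact (hl.getElem_inj_iff).1 hab
  adj := hE

/-! ### Lower bounds -/

lemma edges_eq_singleton_of_isBridge {u w : V} (huw : u ≠ w) (hb : G.IsBridge s(u, w))
    {p : G.Walk u w} (hp : p.IsPath) : p.edges = [s(u, w)] := by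
  -- The bridge lies on `p`; were it not the first edge, `p` would return to `u`.
  have hmem := isBridge_iff_forall_walk_mem_edges.1 hb p
  cases p with
  | nil => exact absurd rfl huw
  | @cons _ x _ h q =>
    rw [Walk.cons_isPath_iff] at hp
    rw [Walk.edges_cons, List.mem_cons] at hmem
    rcases hmem with hmem | hmem
    · obtain rfl : w = x := by simpa [huw, h.ne] using hmem
      rw [(Walk.isPath_iff_nil.1 hp.1).eq_nil]
      simp
    · exact absurd (q.fst_mem_support_of_mem_edges hmem) hp.2

lemma edges_eq_pair_of_isBridge {u v w : V} (huw : u ≠ w) (hvw : v ≠ w) (huv : u ≠ v)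
    (hbu : G.IsBridge s(u, w)) (hbv : G.IsBridge s(v, w)) (hv : G.Adj v w)
    {p : G.Walk u v} (hp : p.IsPath) : p.edges = [s(u, w), s(w, v)] := by
  classical
  -- Prolonging `p` by `vw` gives a walk from `u` to `w`, which must use the bridge `uw`. Hence `p`
  -- passes through `w`, and each half of it joins the ends of a bridge.
  have hmem := isBridge_iff_forall_walk_mem_edges.1 hbu (p.concat hv)
  rw [Walk.edges_concat, List.concat_eq_append, List.mem_append] at hmem
  have hw : w ∈ p.support := by
    rcases hmem with hmem | hmem
    · exact p.snd_mem_support_of_mem_edges hmem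
    · simp [huv, huw] at hmem
  have h1 := edges_eq_singleton_of_isBridge huw hbu (hp.takeUntil hw)
  have h2 := edges_eq_singleton_of_isBridge hvw hbv (hp.dropUntil hw).reverse
  rw [Walk.edges_reverse, List.reverse_eq_iff] at h2
  rw [← p.take_spec hw, Walk.edges_append, h1, h2, Sym2.eq_swap (a := v)]
  rfl

lemma IsConflictFreeConnection.ne_of_isBridge {c : G.EdgeLabeling K}
    (hc : IsConflictFreeConnection c) {u v w : V} (huv : u ≠ v) (hu : G.Adj u w) (hv : G.Adj v w)
    (hbu : G.IsBridge s(u, w)) (hbv : G.IsBridge s(v, w)) :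
    c ⟨s(u, w), hu⟩ ≠ c ⟨s(v, w), hv⟩ := by
  intro heq
  obtain ⟨p, hp, a, ⟨e, he⟩, ⟨hm, ha⟩, huniq⟩ := hc u v huv
  have hed := edges_eq_pair_of_isBridge hu.ne hv.ne huv hbu hbv hv hp
  simp only [hed, List.mem_cons, List.not_mem_nil, or_false] at hm huniq
  have hne : s(u, w) ≠ s(v, w) := by simp [huv, hu.ne]
  rw [Sym2.eq_swap (a := w)] at hm
  rcases hm with rfl | rfl
  · exact hne (congrArg Subtype.val (huniq ⟨_, hv⟩ ⟨Or.inr Sym2.eq_swap, heq ▸ ha⟩)).symm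
  · exact hne (congrArg Subtype.val (huniq ⟨_, hu⟩ ⟨Or.inl rfl, heq ▸ ha⟩))

/-- The number of bridges at a vertex bounds `cfc` from below. -/
lemma card_le_cfc_of_isBridge [Fintype V] (hG : G.Connected) {w : V} {S : Finset V}
    (hS : ∀ u ∈ S, G.Adj u w) (hb : ∀ u ∈ S, G.IsBridge s(u, w)) : S.card ≤ cfc G := by
  obtain ⟨c, hc⟩ := exists_isConflictFreeConnection hG
  have hinj : Function.Injective fun u : S ↦ c ⟨s(u.1, w), hS u.1 u.2⟩ := by
    intro u v huv
    by_contra hne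
    exact hc.ne_of_isBridge (fun h ↦ hne (Subtype.ext h)) (hS u.1 u.2) (hS v.1 v.2)
      (hb u.1 u.2) (hb v.1 v.2) huv
  simpa using Fintype.card_le_of_injective _ hinj

lemma degree_le_cfc_of_isAcyclic [Fintype V] [DecidableRel G.Adj] (hG : G.Connected)
    (ha : G.IsAcyclic) (w : V) : G.degree w ≤ cfc G :=
  card_le_cfc_of_isBridge hG (fun u hu ↦ ((G.mem_neighborFinset w u).1 hu).symm)
    fun u hu ↦ isAcyclic_iff_forall_adj_isBridge.1 ha ((G.mem_neighborFinset w u).1 hu).symm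

lemma IsConflictFreeConnection.ne_of_isAcyclic {c : G.EdgeLabeling K}
    (hc : IsConflictFreeConnection c) (ha : G.IsAcyclic) {u v w : V} (huv : u ≠ v)
    (hu : G.Adj u w) (hv : G.Adj w v) : c ⟨s(u, w), hu⟩ ≠ c ⟨s(w, v), hv⟩ := by
  have := hc.ne_of_isBridge huv hu hv.symm (isAcyclic_iff_forall_adj_isBridge.1 ha hu)
    (isAcyclic_iff_forall_adj_isBridge.1 ha hv.symm)
  convert this using 3
  exact Subtype.ext Sym2.eq_swap

/-- In an acyclic graph no path of length four has its colors alternating. -/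
lemma IsConflictFreeConnection.not_alternating {c : G.EdgeLabeling K}
    (hc : IsConflictFreeConnection c) (ha : G.IsAcyclic) {v₀ v₁ v₂ v₃ v₄ : V}
    (hd : [v₀, v₁, v₂, v₃, v₄].Nodup) (h₀ : G.Adj v₀ v₁) (h₁ : G.Adj v₁ v₂) (h₂ : G.Adj v₂ v₃)
    (h₃ : G.Adj v₃ v₄) (h02 : c ⟨s(v₀, v₁), h₀⟩ = c ⟨s(v₂, v₃), h₂⟩)
    (h13 : c ⟨s(v₁, v₂), h₁⟩ = c ⟨s(v₃, v₄), h₃⟩) : False := by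
  let p : G.Walk v₀ v₄ := .cons h₀ (.cons h₁ (.cons h₂ (.cons h₃ .nil)))
  have hp : p.IsPath := by
    rw [Walk.isPath_def]
    exact hd
  simp only [List.nodup_cons, List.mem_cons, List.not_mem_nil, or_false, not_or] at hd
  obtain ⟨q, hq, a, ⟨e, he⟩, ⟨hm, hca⟩, huniq⟩ := hc v₀ v₄ (by tauto)
  have hqp : q = p := congrArg Subtype.val
    ((ha.subsingleton_path v₀ v₄).elim ⟨q, hq⟩ ⟨p, hp⟩)
  subst hqp
  have hmem (e' : Sym2 V) : e' ∈ p.edges ↔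
      e' = s(v₀, v₁) ∨ e' = s(v₁, v₂) ∨ e' = s(v₂, v₃) ∨ e' = s(v₃, v₄) := by simp [p]
  have n02 : s(v₀, v₁) ≠ s(v₂, v₃) := by simp; tauto
  have n13 : s(v₁, v₂) ≠ s(v₃, v₄) := by simp; tauto
  have key {x y x' y' : V} (h : G.Adj x y) (h' : G.Adj x' y') (hne : s(x, y) ≠ s(x', y'))
      (hcc : c ⟨s(x, y), h⟩ = c ⟨s(x', y'), h'⟩) (hmem' : s(x', y') ∈ p.edges)
      (heq : e = s(x, y)) : False := by
    subst heq
    exact hne (congrArg Subtype.val (huniq ⟨_, h'⟩ ⟨hmem', hcc ▸ hca⟩)).symm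
  rcases (hmem e).1 hm with h | h | h | h
  · exact key h₀ h₂ n02 h02 (by simp [hmem]) h
  · exact key h₁ h₃ n13 h13 (by simp [hmem]) h
  · exact key h₂ h₀ n02.symm h02.symm (by simp [hmem]) h
  · exact key h₃ h₁ n13.symm h13.symm (by simp [hmem]) h

/-- Consecutive edges in a forest differ in color, so with two colors a path of four edges would
alternate. -/
lemma three_le_cfc_of_isAcyclic [Fintype V] (hG : G.Connected) (ha : G.IsAcyclic)
    {v₀ v₁ v₂ v₃ v₄ : V} (hd : [v₀, v₁, v₂, v₃, v₄].Nodup) (h₀ : G.Adj v₀ v₁) (h₁ : G.Adj v₁ v₂)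
    (h₂ : G.Adj v₂ v₃) (h₃ : G.Adj v₃ v₄) : 3 ≤ cfc G := by
  by_contra hlt
  obtain ⟨c, hc⟩ := exists_coloring_of_cfc_le hG (k := 2) (by omega)
  have hd' := hd
  simp only [List.nodup_cons, List.mem_cons, List.not_mem_nil, or_false, not_or] at hd'
  have h01 := hc.ne_of_isAcyclic ha (by tauto) h₀ h₁
  have h12 := hc.ne_of_isAcyclic ha (by tauto) h₁ h₂
  have h23 := hc.ne_of_isAcyclic ha (by tauto) h₂ h₃
  exact hc.not_alternating ha hd h₀ h₁ h₂ h₃ (by omega) (by omega)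

/-- With three colors, the edges considered at `a` show all of them, so some `xᵢa` has the color of
`mb`; likewise some `byⱼ` has the color of `am`. Then `xᵢ a m b yⱼ` alternates. -/
lemma four_le_cfc_of_isAcyclic [Fintype V] (hG : G.Connected) (ha : G.IsAcyclic)
    {x₁ x₂ a m b y₁ y₂ : V} (hd : [x₁, x₂, a, m, b, y₁, y₂].Nodup) (hx₁ : G.Adj x₁ a)
    (hx₂ : G.Adj x₂ a) (ham : G.Adj a m) (hmb : G.Adj m b) (hy₁ : G.Adj b y₁)
    (hy₂ : G.Adj b y₂) : 4 ≤ cfc G := by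
  by_contra hlt
  obtain ⟨c, hc⟩ := exists_coloring_of_cfc_le hG (k := 3) (by omega)
  simp only [List.nodup_cons, List.mem_cons, List.not_mem_nil, or_false, not_or] at hd
  have h1 := hc.ne_of_isAcyclic ha (by tauto) hx₁ ham
  have h2 := hc.ne_of_isAcyclic ha (by tauto) hx₂ ham
  have h3 := hc.ne_of_isAcyclic ha (by tauto) hx₁ hx₂.symm
  rw [show (⟨s(a, x₂), hx₂.symm⟩ : G.edgeSet) = ⟨s(x₂, a), hx₂⟩ from Subtype.ext Sym2.eq_swap] at h3
  have h4 := hc.ne_of_isAcyclic ha (by tauto) ham hmb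
  have h5 := hc.ne_of_isAcyclic ha (by tauto) hmb hy₁
  have h6 := hc.ne_of_isAcyclic ha (by tauto) hmb hy₂
  have h7 := hc.ne_of_isAcyclic ha (by tauto) hy₁.symm hy₂
  rw [show (⟨s(y₁, b), hy₁.symm⟩ : G.edgeSet) = ⟨s(b, y₁), hy₁⟩ from Subtype.ext Sym2.eq_swap] at h7
  obtain ⟨x, hx, hxa, hcx⟩ : ∃ x, ∃ hx : G.Adj x a, (x = x₁ ∨ x = x₂) ∧
      c ⟨s(x, a), hx⟩ = c ⟨s(m, b), hmb⟩ := by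
    by_cases h : c ⟨s(x₁, a), hx₁⟩ = c ⟨s(m, b), hmb⟩
    · exact ⟨x₁, hx₁, Or.inl rfl, h⟩
    · exact ⟨x₂, hx₂, Or.inr rfl, by omega⟩
  obtain ⟨y, hy, hyb, hcy⟩ : ∃ y, ∃ hy : G.Adj b y, (y = y₁ ∨ y = y₂) ∧
      c ⟨s(a, m), ham⟩ = c ⟨s(b, y), hy⟩ := by
    by_cases h : c ⟨s(a, m), ham⟩ = c ⟨s(b, y₁), hy₁⟩
    · exact ⟨y₁, hy₁, Or.inl rfl, h⟩
    · exact ⟨y₂, hy₂, Or.inr rfl, by omega⟩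
  refine hc.not_alternating ha ?_ hx ham hmb hy hcx hcy
  simp only [List.nodup_cons, List.mem_cons, List.not_mem_nil, or_false, not_or,
    not_false_eq_true, and_true, List.nodup_nil]
  rcases hxa with rfl | rfl <;> rcases hyb with rfl | rfl <;> tauto

/-- In a single color, a path on which that color occurs once is an edge. -/
lemma eq_top_of_cfc_le_one [Fintype V] (hG : G.Connected) (h : cfc G ≤ 1) : G = ⊤ := by
  obtain ⟨c, hc⟩ := exists_coloring_of_cfc_le hG h
  ext x y
  refine ⟨fun h ↦ h.ne, fun hxy ↦ ?_⟩
  obtain ⟨p, hp, a, e, ⟨he, hea⟩, hu⟩ := hc x y hxy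
  cases p with
  | nil => exact absurd rfl hxy
  | @cons _ z _ hz q =>
    cases q with
    | nil => exact hz
    | @cons _ w _ hw r =>
      exfalso
      have h1 := hu ⟨s(x, z), hz⟩ ⟨by simp, Subsingleton.elim _ _⟩
      have h2 := hu ⟨s(z, w), hw⟩ ⟨by simp, Subsingleton.elim _ _⟩
      have h3 : s(x, z) = s(z, w) := congrArg Subtype.val (h1.trans h2.symm)
      have : x = w := by simpa [hz.ne] using h3
      subst this
      simp [Walk.cons_isPath_iff] at hp

lemma cfc_pos [Fintype V] (hG : G.Connected) (hn : 2 ≤ Fintype.card V) : 0 < cfc G := by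
  by_contra h
  obtain ⟨c, hc⟩ := exists_coloring_of_cfc_le hG (k := 0) (by omega)
  obtain ⟨x, y, hxy⟩ := Fintype.exists_pair_of_one_lt_card hn
  obtain ⟨p, -, a, -⟩ := hc x y hxy
  exact a.elim0

lemma cfc_top_le [Fintype V] : cfc (⊤ : SimpleGraph V) ≤ 1 :=
  Nat.sInf_le ⟨fun _ ↦ 0, fun x y hxy ↦ ⟨.cons ((top_adj x y).2 hxy) .nil, by simpa using hxy,
    0, ⟨s(x, y), hxy⟩, by simp, by simp +contextual⟩⟩

/-! ### Graphs with a cycle -/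

lemma nodup_four {a b c d : V} : [a, b, c, d].Nodup ↔ (a ≠ b ∧ a ≠ c ∧ a ≠ d) ∧ (b ≠ c ∧ b ≠ d) ∧
    c ≠ d := by simp

lemma nodup_five {a b c d e : V} : [a, b, c, d, e].Nodup ↔ (a ≠ b ∧ a ≠ c ∧ a ≠ d ∧ a ≠ e) ∧
    (b ≠ c ∧ b ≠ d ∧ b ≠ e) ∧ (c ≠ d ∧ c ≠ e) ∧ d ≠ e := by simp

lemma nodup_six {a b c d e f : V} : [a, b, c, d, e, f].Nodup ↔
    (a ≠ b ∧ a ≠ c ∧ a ≠ d ∧ a ≠ e ∧ a ≠ f) ∧ (b ≠ c ∧ b ≠ d ∧ b ≠ e ∧ b ≠ f) ∧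
    (c ≠ d ∧ c ≠ e ∧ c ≠ f) ∧ (d ≠ e ∧ d ≠ f) ∧ e ≠ f := by simp

lemma Embeds.nodup_map {E : List (ℕ × ℕ)} {m : ℕ} {f : ℕ → V} (h : Embeds G E m f) :
    ((List.range m).map f).Nodup :=
  List.Nodup.map_on (fun _ ha _ hb ↦ h.inj (List.mem_range.1 ha) (List.mem_range.1 hb))
    List.nodup_range

lemma cfc_add_le_of_list [Fintype V] (hG : G.Connected) {E : List (ℕ × ℕ)} {l : List V} {m k : ℕ}
    (d : V) (hl : l.Nodup) (hm : l.length = m)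
    (hE : ∀ e ∈ E, e.1 < l.length ∧ e.2 < l.length ∧ G.Adj (l.getD e.1 d) (l.getD e.2 d))
    (W : List (List ℕ)) (hc : colorable E m k W = true) (hm0 : 0 < m := by norm_num)
    (hk : 0 < k := by norm_num) : cfc G + m ≤ k + Fintype.card V := by
  subst hm
  exact (embeds_of_list d hl hE).cfc_add_le hG W hc hm0 hk

/-- The edges of the cycle `0, 1, …, m - 1`. -/
def cycleEdges (m : ℕ) : List (ℕ × ℕ) := (List.range m).map fun i ↦ (i, (i + 1) % m)

lemma exists_embeds_cycleEdges (h : ¬ G.IsAcyclic) :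
    ∃ m, 3 ≤ m ∧ ∃ f : ℕ → V, Embeds G (cycleEdges m) m f := by
  simp only [IsAcyclic, not_forall, not_not] at h
  obtain ⟨v, p, hp⟩ := h
  refine ⟨p.length, hp.three_le_length, p.getVert, fun a ha b hb hab ↦ ?_, fun e he ↦ ?_⟩
  · exact hp.getVert_injOn' (by simp at ha ⊢; omega) (by simp at hb ⊢; omega) hab
  · obtain ⟨i, hi, rfl⟩ := List.mem_map.1 he
    rw [List.mem_range] at hi
    refine ⟨hi, Nat.mod_lt _ (by omega), ?_⟩
    have := p.adj_getVert_succ hi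
    rcases (Nat.succ_le_iff.2 hi).lt_or_eq with h | h
    · simpa [Nat.mod_eq_of_lt h] using this
    · have h' : i + 1 = p.length := h
      simpa [h'] using this

lemma Embeds.cfc_add_four_le_of_cycle_four [Fintype V] (hG : G.Connected)
    (hn : 6 ≤ Fintype.card V) {f : ℕ → V} (h : Embeds G (cycleEdges 4) 4 f) :
    cfc G + 4 ≤ Fintype.card V := by
  obtain ⟨i, hi, v, h⟩ := h.exists_cons hG (by norm_num) (by omega)
  obtain ⟨j, hj, w, h⟩ := h.exists_cons hG (by norm_num) (by omega)
  -- Color `1` marks one edge of the cycle and the edge to `4`. Choosing the arc suitably, any two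
  -- vertices are joined by a path through exactly one marked edge, or by a single edge.
  have key : ∀ i < 4, ∀ j < 5, colorable ((j, 5) :: (i, 4) :: cycleEdges 4) 6 2
      [[0, 1, 0, 0, 0, 1]] = true := by decide +kernel
  have := h.cfc_add_le hG _ (key i hi j hj)
  omega

lemma Embeds.cfc_add_four_le_of_cycle [Fintype V] (hG : G.Connected)
    (hn : 6 ≤ Fintype.card V) {m : ℕ} (hm : 4 ≤ m) {f : ℕ → V} (h : Embeds G (cycleEdges m) m f) :
    cfc G + 4 ≤ Fintype.card V := by
  rcases (by omega : m = 4 ∨ m = 5 ∨ m = 6 ∨ 7 ≤ m) with rfl | rfl | rfl | hm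
  · exact h.cfc_add_four_le_of_cycle_four hG hn
  · obtain ⟨i, hi, v, h⟩ := h.exists_cons hG (by norm_num) (by omega)
    have key : ∀ i < 5, colorable ((i, 5) :: cycleEdges 5) 6 2
        [[0, 0, 0, 0, 0, 1]] = true := by decide +kernel
    have := h.cfc_add_le hG _ (key i hi)
    omega
  · have := h.cfc_add_le hG (k := 2) [[0, 0, 0, 0, 0, 1]] (by decide +kernel)
    omega
  -- Seven consecutive vertices suffice. In the ruler sequence `0, 1, 0, 2, 0, 1` the largest color
  -- of any interval occurs once.
  · have h7 : Embeds G ((List.range 6).map fun i ↦ (i, i + 1)) 7 f := by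
      refine ⟨h.inj.mono (Set.Iio_subset_Iio hm), fun e he ↦ ?_⟩
      obtain ⟨i, hi, rfl⟩ := List.mem_map.1 he
      rw [List.mem_range] at hi
      have := (h.adj (i, (i + 1) % m)
        (List.mem_map_of_mem (List.mem_range.2 (by omega : i < m)))).2.2
      rw [Nat.mod_eq_of_lt (by omega)] at this
      exact ⟨by omega, by omega, this⟩
    have := h7.cfc_add_le hG (k := 3) [[0, 1, 0, 2, 0, 1]] (by decide +kernel)
    omega

/-- The triangle `0 1 2` with further vertices `3`, `4`, `5` attached to `i`, `j`, `k`. -/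
def triangleEdges (i j k : ℕ) : List (ℕ × ℕ) := (k, 5) :: (j, 4) :: (i, 3) :: cycleEdges 3

/-- The exceptions are the shapes with three bridges at one vertex, which two colors cannot serve:
three edges attached at one triangle vertex, or two at the vertex `3`. -/
lemma colorable_triangleEdges : ∀ i < 3, ∀ j < 4, ∀ k < 5, (i = j ∧ j = k) ∨ (j = 3 ∧ k = 3) ∨
    colorable (triangleEdges i j k) 6 2 [[0, 0, 1, 0, 0, 1], [0, 1, 0, 0, 0, 1]] = true := by
  decide +kernel

lemma cfc_add_four_le_of_four_cycle [Fintype V] (hG : G.Connected) (hn : 6 ≤ Fintype.card V)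
    {a b c d : V} (hl : [a, b, c, d].Nodup) (hab : G.Adj a b) (hbc : G.Adj b c) (hcd : G.Adj c d)
    (hda : G.Adj d a) : cfc G + 4 ≤ Fintype.card V :=
  (embeds_of_list (E := cycleEdges 4) a hl
    (by simp [cycleEdges, List.range_succ, *])).cfc_add_four_le_of_cycle_four hG hn

lemma cfc_add_four_le_of_triangle [Fintype V] (hG : G.Connected)
    {a b c x y z : V} (hl : [a, b, c, x, y, z].Nodup) (hab : G.Adj a b) (hbc : G.Adj b c)
    (hca : G.Adj c a) (i j k : ℕ) (hx : G.Adj ([a, b, c, x, y, z].getD i a) x)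
    (hy : G.Adj ([a, b, c, x, y, z].getD j a) y) (hz : G.Adj ([a, b, c, x, y, z].getD k a) z)
    (hi : i < 3 := by norm_num) (hj : j < 4 := by norm_num) (hk : k < 5 := by norm_num)
    (h1 : ¬ (i = j ∧ j = k) := by norm_num) (h2 : ¬ (j = 3 ∧ k = 3) := by norm_num) :
    cfc G + 4 ≤ Fintype.card V := by
  have hc := ((colorable_triangleEdges i hi j hj k hk).resolve_left h1).resolve_left h2
  have := cfc_add_le_of_list hG a hl (m := 6) rfl (E := triangleEdges i j k) ?_ _ hc
  · omega
  · simp only [triangleEdges, cycleEdges, List.range_succ, List.forall_mem_cons, List.length_cons,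
      List.length_nil]
    refine ⟨⟨by omega, by omega, hz⟩, ⟨by omega, by omega, hy⟩, ⟨by omega, by omega, hx⟩, ?_⟩
    simp [*]

lemma isStarAddEdge_of_triangle [Fintype V] (hG : G.Connected) (hn : 6 ≤ Fintype.card V)
    (h : Fintype.card V < cfc G + 4) {a b c x y z : V} (hl : [a, b, c, x, y, z].Nodup)
    (hab : G.Adj a b) (hbc : G.Adj b c) (hca : G.Adj c a) (hx : G.Adj a x) (hy : G.Adj a y)
    (hz : G.Adj a z) : IsStarAddEdge G := by
  rw [nodup_six] at hl
  have hac := hca.symm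
  -- Otherwise an edge leaves the closed neighborhood of `a`, and together with two edges at `a` it
  -- attaches to the triangle in a non-exceptional way.
  have hall : ∀ v, v ≠ a → G.Adj a v := by
    by_contra! hv
    obtain ⟨v, hva, hv⟩ := hv
    obtain ⟨s, hs, w, hw, hsw⟩ := hG.exists_adj_boundary
      (S := {v | v = a ∨ G.Adj a v}) (x := a) (y := v) (by simp) (by simp [hva, hv])
    simp only [Set.mem_ofPred_eq, not_or] at hs hw
    have hsa : s ≠ a := by rintro rfl; exact hw.2 hsw
    replace hs := hs.resolve_left hsa
    by_cases hsb : s = b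
    · have := cfc_add_four_le_of_triangle hG (a := a) (b := b) (c := c) (x := x) (y := y) (z := w)
        (nodup_six.2 (by grind)) hab hbc hca 0 0 1 hx hy (hsb ▸ hsw)
      omega
    by_cases hsc : s = c
    · have := cfc_add_four_le_of_triangle hG (a := a) (b := b) (c := c) (x := x) (y := y) (z := w)
        (nodup_six.2 (by grind)) hab hbc hca 0 0 2 hx hy (hsc ▸ hsw)
      omega
    obtain ⟨t, ht, hts, htb, htc, hta⟩ : ∃ t, G.Adj a t ∧ t ≠ s ∧ t ≠ b ∧ t ≠ c ∧ t ≠ a := by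
      by_cases hsx : s = x
      · exact ⟨y, hy, by grind⟩
      · exact ⟨x, hx, by grind⟩
    have := cfc_add_four_le_of_triangle hG (a := a) (b := b) (c := c) (x := s) (y := t) (z := w)
      (nodup_six.2 (by grind)) hab hbc hca 0 0 3 hs ht hsw
    omega
  have hC4 (v : V) (hva : v ≠ a) (hvb : v ≠ b) (hvc : v ≠ c) : ¬ G.Adj b v ∧ ¬ G.Adj c v := by
    refine ⟨fun hv ↦ ?_, fun hv ↦ ?_⟩
    · have := cfc_add_four_le_of_four_cycle hG hn (a := a) (b := v) (c := b) (d := c)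
        (nodup_four.2 (by grind)) (hall v hva) hv.symm hbc hca
      omega
    · have := cfc_add_four_le_of_four_cycle hG hn (a := a) (b := v) (c := c) (d := b)
        (nodup_four.2 (by grind)) (hall v hva) hv.symm hbc.symm hab.symm
      omega
  have hext (u v : V) (hua : u ≠ a) (hva : v ≠ a) (hub : u ≠ b) (huc : u ≠ c) (hvb : v ≠ b)
      (hvc : v ≠ c) : ¬ G.Adj u v := by
    intro huv
    obtain ⟨t, ht, htu, htv, htb, htc, hta⟩ :
        ∃ t, G.Adj a t ∧ t ≠ u ∧ t ≠ v ∧ t ≠ b ∧ t ≠ c ∧ t ≠ a := by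
      by_cases hux : x ≠ u ∧ x ≠ v
      · exact ⟨x, hx, by grind⟩
      by_cases huy : y ≠ u ∧ y ≠ v
      · exact ⟨y, hy, by grind⟩
      · exact ⟨z, hz, by grind⟩
    -- A second triangle `a u v` takes over; of the old one only the path `a b c` is kept.
    have := cfc_add_four_le_of_triangle hG (a := a) (b := u) (c := v) (x := b) (y := t) (z := c)
      (nodup_six.2 (by grind [huv.ne])) (hall u hua) huv (hall v hva).symm 0 0 3 hab ht hbc
    omega
  refine ⟨a, b, c, hab.ne', hca.ne, hbc.ne, ?_⟩
  ext u v
  rw [sup_adj, starGraph_adj, edge_adj]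
  constructor
  · intro huv
    have hvu := huv.symm
    have hne := huv.ne
    by_cases hua : u = a
    · grind
    by_cases hva : v = a
    · grind
    have := hext u v hua hva
    have h1 := hC4 u hua
    have h2 := hC4 v hva
    by_cases u = b <;> by_cases u = c <;> by_cases v = b <;> by_cases v = c <;> grind
  · rintro (⟨huv, h⟩ | ⟨⟨rfl, rfl⟩ | ⟨rfl, rfl⟩, -⟩)
    · rcases h with rfl | rfl
      · exact hall v huv.symm
      · exact (hall u huv).symm
    · exact hbc
    · exact hbc.symm

lemma isU_of_triangle [Fintype V] (hG : G.Connected) (hn : 6 ≤ Fintype.card V)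
    (h : Fintype.card V < cfc G + 4) {a b c u z₁ z₂ : V} (hl : [a, b, c, u, z₁, z₂].Nodup)
    (hab : G.Adj a b) (hbc : G.Adj b c) (hca : G.Adj c a) (hu : G.Adj a u) (hz₁ : G.Adj u z₁)
    (hz₂ : G.Adj u z₂) : IsU G := by
  rw [nodup_six] at hl
  have hac := hca.symm
  have hother (t : V) : ∃ s, G.Adj u s ∧ s ≠ t ∧ s ≠ a ∧ s ≠ b ∧ s ≠ c ∧ s ≠ u := by
    by_cases ht : z₁ = t
    · exact ⟨z₂, hz₂, by grind⟩
    · exact ⟨z₁, hz₁, by grind⟩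
  have hall : ∀ v, v ≠ u → v ≠ b → v ≠ c → G.Adj u v := by
    by_contra! hv
    obtain ⟨v, hvu, hvb, hvc, hv⟩ := hv
    obtain ⟨s, hs, w, hw, hsw⟩ := hG.exists_adj_boundary
      (S := {v | v = u ∨ v = b ∨ v = c ∨ G.Adj u v}) (x := u) (y := v) (by simp)
      (by simp [hvu, hv, hvb, hvc])
    simp only [Set.mem_ofPred_eq, not_or] at hs hw
    have hsu : s ≠ u := by rintro rfl; exact hw.2.2.2 hsw
    have hwa : w ≠ a := by rintro rfl; exact hw.2.2.2 hu.symm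
    have hwz : w ≠ z₁ := by rintro rfl; exact hw.2.2.2 hz₁
    by_cases hsa : s = a
    · have := cfc_add_four_le_of_triangle hG (a := a) (b := b) (c := c) (x := u) (y := w) (z := z₁)
        (nodup_six.2 (by grind)) hab hbc hca 0 0 3 hu (hsa ▸ hsw) hz₁
      omega
    by_cases hsb : s = b
    · have := cfc_add_four_le_of_triangle hG (a := a) (b := b) (c := c) (x := u) (y := w) (z := z₁)
        (nodup_six.2 (by grind)) hab hbc hca 0 1 3 hu (hsb ▸ hsw) hz₁
      omega
    by_cases hsc : s = c
    · have := cfc_add_four_le_of_triangle hG (a := a) (b := b) (c := c) (x := u) (y := w) (z := z₁)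
        (nodup_six.2 (by grind)) hab hbc hca 0 2 3 hu (hsc ▸ hsw) hz₁
      omega
    have hus : G.Adj u s := by tauto
    have := cfc_add_four_le_of_triangle hG (a := a) (b := b) (c := c) (x := u) (y := s) (z := w)
      (nodup_six.2 (by grind [hsw.ne])) hab hbc hca 0 3 4 hu hus hsw
    omega
  have hub : ¬ G.Adj u b := fun hub ↦ by
    have := cfc_add_four_le_of_four_cycle hG hn (a := u) (b := b) (c := c) (d := a)
      (nodup_four.2 (by grind)) hub hbc hca hu
    omega
  have huc : ¬ G.Adj u c := fun huc ↦ by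
    have := cfc_add_four_le_of_four_cycle hG hn (a := u) (b := c) (c := b) (d := a)
      (nodup_four.2 (by grind)) huc hbc.symm hab.symm hu
    omega
  have hone (v : V) (hvu : v ≠ u) (hva : v ≠ a) (hvb : v ≠ b) (hvc : v ≠ c) :
      ¬ G.Adj a v ∧ ¬ G.Adj b v ∧ ¬ G.Adj c v := by
    have huv := hall v hvu hvb hvc
    refine ⟨fun hv ↦ ?_, fun hv ↦ ?_, fun hv ↦ ?_⟩
    · obtain ⟨s, hs, hst, hsa, hsb, hsc, hsu⟩ := hother v
      have := cfc_add_four_le_of_triangle hG (a := a) (b := b) (c := c) (x := v) (y := u) (z := s)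
        (nodup_six.2 (by grind)) hab hbc hca 0 0 4 hv hu hs
      omega
    · have := cfc_add_four_le_of_four_cycle hG hn (a := b) (b := a) (c := u) (d := v)
        (nodup_four.2 (by grind)) hab.symm hu huv hv.symm
      omega
    · have := cfc_add_four_le_of_four_cycle hG hn (a := c) (b := a) (c := u) (d := v)
        (nodup_four.2 (by grind)) hca hu huv hv.symm
      omega
  have hext (v w : V) (hvu : v ≠ u) (hva : v ≠ a) (hvb : v ≠ b) (hvc : v ≠ c) (hwu : w ≠ u)
      (hwa : w ≠ a) (hwb : w ≠ b) (hwc : w ≠ c) : ¬ G.Adj v w := by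
    intro hvw
    -- The triangle is now `u v w`, with the path `u a b c` hanging from it.
    have := cfc_add_four_le_of_triangle hG (a := u) (b := v) (c := w) (x := a) (y := b) (z := c)
      (nodup_six.2 (by grind [hvw.ne])) (hall v hvu hvb hvc) hvw (hall w hwu hwb hwc).symm 0 3 4 hu.symm hab hbc
    omega
  refine ⟨a, u, b, c, z₁, nodup_five.2 (by grind), ?_⟩
  ext v w
  simp only [doubleStar, sup_adj, fromRel_adj, edge_adj]
  constructor
  · intro hvw
    have hwv := hvw.symm
    have hne := hvw.ne
    have h1 := hext v w
    have h2 := hone v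
    have h3 := hone w
    by_cases hvu : v = u
    · grind
    by_cases hwu : w = u
    · grind
    by_cases v = a <;> by_cases v = b <;> by_cases v = c <;> by_cases w = a <;>
      by_cases w = b <;> by_cases w = c <;> grind
  · have hba := hab.symm
    have hcb := hbc.symm
    have hall' (v) (h1 : v ≠ u) (h2 : v ≠ b) (h3 : v ≠ c) := (hall v h1 h2 h3).symm
    grind

/-- A connected graph of order at least six with a cycle satisfies `cfc G ≤ n - 4`, unless it is
`K_{1,n-1} + e` or `U_n`. -/
lemma isStarAddEdge_or_isU [Fintype V] (hG : G.Connected) (hn : 6 ≤ Fintype.card V)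
    (ha : ¬ G.IsAcyclic) (h : Fintype.card V < cfc G + 4) : IsStarAddEdge G ∨ IsU G := by
  obtain ⟨m, hm, f, hf⟩ := exists_embeds_cycleEdges ha
  rcases hm.eq_or_lt with rfl | hm
  · obtain ⟨i, hi, x, h1⟩ := hf.exists_cons hG (by norm_num) (by omega)
    obtain ⟨j, hj, y, h2⟩ := h1.exists_cons hG (by norm_num) (by omega)
    obtain ⟨k, hk, z, h3⟩ := h2.exists_cons hG (by norm_num) (by omega)
    set g := Function.update (Function.update (Function.update f 3 x) 4 y) 5 z
    have hnd : [g 0, g 1, g 2, g 3, g 4, g 5].Nodup := h3.nodup_map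
    have h01 : G.Adj (g 0) (g 1) := (h3.adj (0, 1) (by simp [cycleEdges, List.range_succ])).2.2
    have h12 : G.Adj (g 1) (g 2) := (h3.adj (1, 2) (by simp [cycleEdges, List.range_succ])).2.2
    have h20 : G.Adj (g 2) (g 0) := (h3.adj (2, 0) (by simp [cycleEdges, List.range_succ])).2.2
    have hi3 : G.Adj (g i) (g 3) := (h3.adj (i, 3) (by simp)).2.2
    have hj4 : G.Adj (g j) (g 4) := (h3.adj (j, 4) (by simp)).2.2
    have hk5 : G.Adj (g k) (g 5) := (h3.adj (k, 5) (by simp)).2.2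
    rw [nodup_six] at hnd
    rcases colorable_triangleEdges i hi j hj k hk with ⟨rfl, rfl⟩ | ⟨rfl, rfl⟩ | hc
    · left
      interval_cases i
      · exact isStarAddEdge_of_triangle hG hn h (nodup_six.2 (by grind)) h01 h12 h20 hi3 hj4 hk5
      · exact isStarAddEdge_of_triangle hG hn h (nodup_six.2 (by grind)) h12 h20 h01 hi3 hj4 hk5
      · exact isStarAddEdge_of_triangle hG hn h (nodup_six.2 (by grind)) h20 h01 h12 hi3 hj4 hk5
    · right
      interval_cases i
      · exact isU_of_triangle hG hn h (nodup_six.2 (by grind)) h01 h12 h20 hi3 hj4 hk5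
      · exact isU_of_triangle hG hn h (nodup_six.2 (by grind)) h12 h20 h01 hi3 hj4 hk5
      · exact isU_of_triangle hG hn h (nodup_six.2 (by grind)) h20 h01 h12 hi3 hj4 hk5
    · have := h3.cfc_add_le hG _ hc
      omega
  · have := hf.cfc_add_four_le_of_cycle hG hn hm
    omega

lemma mem_of_nodup_of_length [Fintype V] {l : List V} (hl : l.Nodup)
    (hc : Fintype.card V = l.length) (v : V) : v ∈ l := by
  classical
  have : l.toFinset = Finset.univ := by
    rw [← Finset.card_eq_iff_eq_univ, List.toFinset_card_of_nodup hl, hc]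
  simpa [this] using List.mem_toFinset (a := v) (l := l)

/-- A connected graph of order at least five with a cycle satisfies `cfc G ≤ n - 3`. -/
lemma cfc_add_three_le_of_not_isAcyclic [Fintype V] (hG : G.Connected) (hn : 5 ≤ Fintype.card V)
    (ha : ¬ G.IsAcyclic) : cfc G + 3 ≤ Fintype.card V := by
  obtain ⟨m, hm, f, hf⟩ := exists_embeds_cycleEdges ha
  rcases (by omega : m = 3 ∨ m = 4 ∨ m = 5 ∨ 6 ≤ m) with rfl | rfl | rfl | hm6
  · obtain ⟨i, hi, x, h1⟩ := hf.exists_cons hG (by norm_num) (by omega)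
    obtain ⟨j, hj, y, h2⟩ := h1.exists_cons hG (by norm_num) (by omega)
    have key : ∀ i < 3, ∀ j < 4, colorable ((j, 4) :: (i, 3) :: cycleEdges 3) 5 2
        [[0, 1, 0, 0, 1]] = true := by decide +kernel
    have := h2.cfc_add_le hG _ (key i hi j hj)
    omega
  · obtain ⟨i, hi, x, h1⟩ := hf.exists_cons hG (by norm_num) (by omega)
    have key : ∀ i < 4, colorable ((i, 4) :: cycleEdges 4) 5 2 [[0, 0, 0, 0, 1]] = true := by
      decide +kernel
    have := h1.cfc_add_le hG _ (key i hi)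
    omega
  · have := hf.cfc_add_le hG (k := 2) [[0, 0, 0, 0, 1]] (by decide +kernel)
    omega
  · have := hf.cfc_add_four_le_of_cycle hG (hm6.trans hf.card_le) (by omega)
    omega

/-! ### Exact values for the two infinite families with a cycle -/

lemma isBridge_of_cut {S : Set V} {u v : V} (hu : u ∈ S) (hv : v ∉ S)
    (h : ∀ p ∈ S, ∀ q ∉ S, G.Adj p q → p = u ∧ q = v) : G.IsBridge s(u, v) := by
  rw [isBridge_iff_forall_walk_mem_edges]
  intro w
  obtain ⟨d, hd, h1, h2⟩ := w.exists_boundary_dart S hu hv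
  obtain ⟨h3, h4⟩ := h _ h1 _ h2 d.adj
  have := List.mem_map_of_mem (f := Dart.edge) hd
  rwa [show d.edge = s(u, v) by rw [← h3, ← h4]; rfl] at this

lemma not_isAcyclic_of_triangle {a b c : V} (hab : G.Adj a b) (hbc : G.Adj b c)
    (hca : G.Adj c a) : ¬ G.IsAcyclic := by
  intro h
  have := isBridge_iff_forall_walk_mem_edges.1 (isAcyclic_iff_forall_adj_isBridge.1 h hab)
    (.cons hca.symm (.cons hbc.symm .nil))
  simp [hab.ne, hbc.ne] at this
  grind [hab.ne, hbc.ne, hca.ne]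

lemma card_compl_three [Fintype V] [DecidableEq V] {a b c : V} (hab : a ≠ b) (hac : a ≠ c)
    (hbc : b ≠ c) : ({a, b, c}ᶜ : Finset V).card = Fintype.card V - 3 := by
  rw [Finset.card_compl, Finset.card_eq_three.2 ⟨a, b, c, hab, hac, hbc, rfl⟩]

lemma IsStarAddEdge.not_isAcyclic (h : IsStarAddEdge G) : ¬ G.IsAcyclic := by
  obtain ⟨r, x, y, hxr, hyr, hxy, rfl⟩ := h
  refine not_isAcyclic_of_triangle (a := r) (b := x) (c := y) ?_ ?_ ?_ <;>
    simp [edge_adj, starGraph_adj, hxr, hyr, hxy, hxr.symm]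

lemma IsStarAddEdge.cfc_eq [Fintype V] (hG : G.Connected) (hn : 5 ≤ Fintype.card V)
    (h : IsStarAddEdge G) : cfc G = Fintype.card V - 3 := by
  classical
  have h1 := cfc_add_three_le_of_not_isAcyclic hG hn h.not_isAcyclic
  obtain ⟨r, x, y, hxr, hyr, hxy, rfl⟩ := h
  -- The center carries `n - 3` pendant edges outside the triangle.
  have h2 := card_le_cfc_of_isBridge hG (w := r) (S := {r, x, y}ᶜ) ?_ ?_
  · rw [card_compl_three hxr.symm hyr.symm hxy] at h2
    omega
  · intro u hu
    simp only [Finset.mem_compl, Finset.mem_insert, Finset.mem_singleton, not_or] at hu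
    simp [starGraph_adj, hu]
  · intro u hu
    simp only [Finset.mem_compl, Finset.mem_insert, Finset.mem_singleton, not_or] at hu
    refine isBridge_of_cut (S := {u}) rfl (by simpa using Ne.symm hu.1) ?_
    rintro p rfl q - hpq
    rw [sup_adj, starGraph_adj, edge_adj] at hpq
    grind

lemma IsU.not_isAcyclic (h : IsU G) : ¬ G.IsAcyclic := by
  obtain ⟨a, b, x, y, z, hd, rfl⟩ := h
  rw [nodup_five] at hd
  refine not_isAcyclic_of_triangle (a := a) (b := x) (c := y) ?_ ?_ ?_ <;>
    simp [edge_adj, doubleStar, hd, (hd.1.2.2.1).symm]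

lemma IsU.cfc_eq [Fintype V] (hG : G.Connected) (hn : 5 ≤ Fintype.card V)
    (h : IsU G) : cfc G = Fintype.card V - 3 := by
  classical
  have h1 := cfc_add_three_le_of_not_isAcyclic hG hn h.not_isAcyclic
  obtain ⟨a, b, x, y, z, hd, rfl⟩ := h
  rw [nodup_five] at hd
  -- All `n - 3` edges at `b` are bridges: `ab` alone leaves the triangle, and the others are
  -- pendant.
  have h2 := card_le_cfc_of_isBridge hG (w := b) (S := {b, x, y}ᶜ) ?_ ?_
  · rw [card_compl_three (by grind) (by grind) (by grind)] at h2
    omega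
  · intro u hu
    simp only [Finset.mem_compl, Finset.mem_insert, Finset.mem_singleton, not_or] at hu
    simp [doubleStar, hu]
  · intro u hu
    simp only [Finset.mem_compl, Finset.mem_insert, Finset.mem_singleton, not_or] at hu
    by_cases hua : u = a
    · subst hua
      refine isBridge_of_cut (S := {u, x, y}) (by simp) (by simp; grind) ?_
      intro p hp q hq hpq
      simp only [doubleStar, sup_adj, fromRel_adj, edge_adj] at hpq
      simp only [Set.mem_insert_iff, Set.mem_singleton_iff] at hp hq
      grind
    · refine isBridge_of_cut (S := {u}) rfl (by simpa using Ne.symm hu.1) ?_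
      rintro p rfl q - hpq
      simp only [doubleStar, sup_adj, fromRel_adj, edge_adj] at hpq
      grind

/-! ### Graphs of order five with a bridge -/

/-- At most one edge joins `S` to its complement. -/
def IsThinCut (G : SimpleGraph V) (S : Set V) : Prop :=
  ∀ p ∈ S, ∀ q ∉ S, ∀ p' ∈ S, ∀ q' ∉ S, G.Adj p q → G.Adj p' q' → p = p' ∧ q = q'

/-- Some `e` has a deletion that separates two vertices. The set reachable from one of them can then
be left only through `e`. -/
lemma exists_isThinCut (h : ¬ G.IsEdgeConnected 2) :
    ∃ S : Set V, (∃ x, x ∈ S) ∧ (∃ y, y ∉ S) ∧ IsThinCut G S := by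
  rw [isEdgeConnected_two] at h
  simp only [Preconnected, not_forall] at h
  obtain ⟨e, x, y, hxy⟩ := h
  have key : ∀ p, (G.deleteEdges {e}).Reachable x p → ∀ q, ¬ (G.deleteEdges {e}).Reachable x q →
      G.Adj p q → s(p, q) = e := by
    intro p hp q hq hpq
    by_contra hne
    exact hq (hp.trans (deleteEdges_adj.2 ⟨hpq, hne⟩).reachable)
  refine ⟨{v | (G.deleteEdges {e}).Reachable x v}, ⟨x, .rfl⟩, ⟨y, hxy⟩, ?_⟩
  intro p hp q hq p' hp' q' hq' h1 h2
  have := (key p hp q hq h1).trans (key p' hp' q' hq' h2).symm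
  rw [Sym2.eq_iff] at this
  rcases this with h | ⟨rfl, rfl⟩
  · exact h
  · exact absurd hp hq'

/-- A cycle crosses a cut an even number of times, so a thin cut leaves it on one side. This and the
analogues for lengths four and five are by direct cases. -/
lemma IsThinCut.mem_of_triangle {S : Set V} (hS : IsThinCut G S) {a b c : V} (hab : G.Adj a b)
    (hbc : G.Adj b c) (hca : G.Adj c a) (ha : a ∈ S) : b ∈ S := by
  by_contra hb
  by_cases hc : c ∈ S
  · exact hca.ne' (hS a ha b hb c hc b hb hab hbc.symm).1
  · exact hbc.ne (hS a ha b hb a ha c hc hab hca.symm).2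

lemma IsThinCut.mem_iff_of_triangle {S : Set V} (hS : IsThinCut G S) {a b c : V}
    (hab : G.Adj a b) (hbc : G.Adj b c) (hca : G.Adj c a) : a ∈ S ↔ b ∈ S :=
  ⟨hS.mem_of_triangle hab hbc hca, hS.mem_of_triangle hab.symm hca.symm hbc.symm⟩

lemma IsThinCut.mem_of_four_cycle {S : Set V} (hS : IsThinCut G S) {a b c d : V}
    (hac : a ≠ c) (hbd : b ≠ d) (hab : G.Adj a b) (hbc : G.Adj b c) (hcd : G.Adj c d)
    (hda : G.Adj d a) (ha : a ∈ S) : b ∈ S := by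
  by_contra hb
  by_cases hc : c ∈ S
  · exact hac (hS a ha b hb c hc b hb hab hbc.symm).1
  by_cases hd : d ∈ S
  · exact hda.ne' (hS a ha b hb d hd c hc hab hcd.symm).1
  · exact hbd (hS a ha b hb a ha d hd hab hda.symm).2

lemma IsThinCut.mem_iff_of_four_cycle {S : Set V} (hS : IsThinCut G S) {a b c d : V}
    (hac : a ≠ c) (hbd : b ≠ d) (hab : G.Adj a b) (hbc : G.Adj b c) (hcd : G.Adj c d)
    (hda : G.Adj d a) : a ∈ S ↔ b ∈ S :=
  ⟨hS.mem_of_four_cycle hac hbd hab hbc hcd hda,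
    hS.mem_of_four_cycle hbd hac hab.symm hda.symm hcd.symm hbc.symm⟩

lemma IsThinCut.mem_of_five_cycle {S : Set V} (hS : IsThinCut G S) {a b c d e : V}
    (hac : a ≠ c) (had : a ≠ d) (hbe : b ≠ e) (hab : G.Adj a b) (hbc : G.Adj b c)
    (hcd : G.Adj c d) (hde : G.Adj d e) (hea : G.Adj e a) (ha : a ∈ S) : b ∈ S := by
  by_contra hb
  by_cases hc : c ∈ S
  · exact hac (hS a ha b hb c hc b hb hab hbc.symm).1
  by_cases hd : d ∈ S
  · exact had (hS a ha b hb d hd c hc hab hcd.symm).1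
  by_cases he : e ∈ S
  · exact hea.ne' (hS a ha b hb e he d hd hab hde.symm).1
  · exact hbe (hS a ha b hb a ha e he hab hea.symm).2

lemma nonempty_iso_of_injective [Fintype V] {m : ℕ} {H : SimpleGraph (Fin m)}
    (hc : Fintype.card V = m) {f : Fin m → V} (hf : Function.Injective f)
    (h : ∀ i j, i < j → (G.Adj (f i) (f j) ↔ H.Adj i j)) : Nonempty (G ≃g H) := by
  have hb : Function.Bijective f :=
    (Fintype.bijective_iff_injective_and_card f).2 ⟨hf, by simp [hc]⟩
  refine ⟨(⟨Equiv.ofBijective f hb, fun {i j} ↦ ?_⟩ : H ≃g G).symm⟩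
  rcases lt_trichotomy i j with hij | rfl | hij
  · exact h i j hij
  · simp
  · rw [G.adj_comm, H.adj_comm]
    exact h j i hij

lemma nonempty_iso_of_nodup_five [Fintype V] {H : SimpleGraph (Fin 5)}
    (hc : Fintype.card V = 5) {a b c d e : V} (hd : [a, b, c, d, e].Nodup)
    (h₀ : (G.Adj a b ↔ H.Adj 0 1) ∧ (G.Adj a c ↔ H.Adj 0 2) ∧ (G.Adj a d ↔ H.Adj 0 3) ∧
      (G.Adj a e ↔ H.Adj 0 4))
    (h₁ : (G.Adj b c ↔ H.Adj 1 2) ∧ (G.Adj b d ↔ H.Adj 1 3) ∧ (G.Adj b e ↔ H.Adj 1 4))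
    (h₂ : (G.Adj c d ↔ H.Adj 2 3) ∧ (G.Adj c e ↔ H.Adj 2 4)) (h₃ : G.Adj d e ↔ H.Adj 3 4) :
    Nonempty (G ≃g H) := by
  refine nonempty_iso_of_injective hc (f := ![a, b, c, d, e])
    (List.nodup_ofFn.1 (by simpa using hd)) fun i j hij ↦ ?_
  fin_cases i <;> fin_cases j <;> first | (exfalso; revert hij; decide) | skip
  exacts [h₀.1, h₀.2.1, h₀.2.2.1, h₀.2.2.2, h₁.1, h₁.2.1, h₁.2.2, h₂.1, h₂.2, h₃]

/-- The graphs of order five with a bridge and a cycle. -/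
def IsBridgedOrderFive (G : SimpleGraph V) : Prop :=
  IsStarAddEdge G ∨ IsU G ∨ Nonempty (G ≃g bull) ∨ Nonempty (G ≃g cyclePendant) ∨
    Nonempty (G ≃g diamondPendantThree) ∨ Nonempty (G ≃g diamondPendantTwo) ∨
    Nonempty (G ≃g completePendant)

/-- The cycle lies on one side of a thin cut, so `p` is alone on the other and `ap` is its only
edge. The two possible chords of the cycle give the four graphs. -/
lemma isBridgedOrderFive_of_four_cycle [Fintype V] (hc : Fintype.card V = 5)
    (hb : ¬ G.IsEdgeConnected 2) {a b c d p : V} (hd : [a, b, c, d, p].Nodup) (hab : G.Adj a b)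
    (hbc : G.Adj b c) (hcd : G.Adj c d) (hda : G.Adj d a) (hp : G.Adj a p) :
    IsBridgedOrderFive G := by
  obtain ⟨S, ⟨x, hx⟩, ⟨y, hy⟩, hS⟩ := exists_isThinCut hb
  have hV := mem_of_nodup_of_length hd hc
  simp only [List.mem_cons, List.not_mem_nil, or_false] at hV
  have hd' := nodup_five.1 hd
  have hba := hab.symm
  have hcb := hbc.symm
  have hdc := hcd.symm
  have had := hda.symm
  have hpa := hp.symm
  have h1 := hS.mem_iff_of_four_cycle (by grind) (by grind) hab hbc hcd hda
  have h2 := hS.mem_iff_of_four_cycle (by grind) (by grind) hbc hcd hda hab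
  have h3 := hS.mem_iff_of_four_cycle (by grind) (by grind) hcd hda hab hbc
  have hpS : p ∈ S ↔ a ∉ S := by
    by_contra hpS
    have hall : ∀ v, v ∈ S ↔ a ∈ S := fun v ↦ by
      rcases hV v with h | h | h | h | h <;> rw [h]
      exacts [h1.symm, (h1.trans h2).symm, (h1.trans (h2.trans h3)).symm, by tauto]
    exact hy ((hall y).2 ((hall x).1 hx))
  have hpn (v : V) (hva : v ≠ a) (hv : v ∈ S ↔ a ∈ S) : ¬ G.Adj v p := fun h ↦ by
    by_cases haS : a ∈ S
    · exact hva (hS v (hv.2 haS) p (fun hp' ↦ hpS.1 hp' haS) a haS p (fun hp' ↦ hpS.1 hp' haS) h hp).1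
    · exact hva (hS p (hpS.2 haS) v (fun hv' ↦ haS (hv.1 hv')) p (hpS.2 haS) a haS h.symm hp.symm).2
  have hpb : ¬ G.Adj b p := hpn b hab.ne' h1.symm
  have hpc : ¬ G.Adj c p := hpn c (by grind) (h1.trans h2).symm
  have hpd : ¬ G.Adj d p := hpn d hda.ne (h1.trans (h2.trans h3)).symm
  clear hpn hV hS
  right; right; right
  by_cases hac : G.Adj a c <;> by_cases hbd : G.Adj b d
  · right; right; right
    refine nonempty_iso_of_nodup_five hc hd ?_ ?_ ?_ ?_ <;> 
      simp [completePendant, hab, hac, had, hp, hbc, hbd, hpb, hcd, hpc, hpd]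
  · right; left
    refine nonempty_iso_of_nodup_five hc hd ?_ ?_ ?_ ?_ <;> 
      simp [diamondPendantThree, hab, hac, had, hp, hbc, hbd, hpb, hcd, hpc, hpd]
  · right; right; left
    refine nonempty_iso_of_nodup_five hc hd ?_ ?_ ?_ ?_ <;> 
      simp [diamondPendantTwo, hab, hac, had, hp, hbc, hbd, hpb, hcd, hpc, hpd]
  · left
    refine nonempty_iso_of_nodup_five hc hd ?_ ?_ ?_ ?_ <;> 
      simp [cyclePendant, hab, hac, had, hp, hbc, hbd, hpb, hcd, hpc, hpd]

lemma isBridgedOrderFive_of_triangle [Fintype V] (hc : Fintype.card V = 5)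
    (hb : ¬ G.IsEdgeConnected 2) (h4 : ∀ a b c d, [a, b, c, d].Nodup → G.Adj a b → G.Adj b c →
      G.Adj c d → ¬ G.Adj d a) {a b c d e : V} (hd : [a, b, c, d, e].Nodup) (hab : G.Adj a b)
    (hbc : G.Adj b c) (hca : G.Adj c a) (had : G.Adj a d)
    (he : G.Adj a e ∨ G.Adj b e ∨ G.Adj c e ∨ G.Adj d e) : IsBridgedOrderFive G := by
  obtain ⟨S, ⟨x, hx⟩, ⟨y, hy⟩, hS⟩ := exists_isThinCut hb
  have hV := mem_of_nodup_of_length hd hc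
  simp only [List.mem_cons, List.not_mem_nil, or_false] at hV
  have hd' := nodup_five.1 hd
  have hba := hab.symm
  have hcb := hbc.symm
  have hac := hca.symm
  have hda := had.symm
  have hbd : ¬ G.Adj b d := fun h ↦
    h4 a d b c (nodup_four.2 (by grind)) had h.symm hbc hca
  have hcd : ¬ G.Adj c d := fun h ↦
    h4 a d c b (nodup_four.2 (by grind)) had h.symm hcb hba
  by_cases hae : G.Adj a e
  · have hbe : ¬ G.Adj b e := fun h ↦
      h4 a e b c (nodup_four.2 (by grind)) hae h.symm hbc hca
    have hce : ¬ G.Adj c e := fun h ↦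
      h4 a e c b (nodup_four.2 (by grind)) hae h.symm hcb hba
    have hea := hae.symm
    -- With `de` there would be two triangles sharing `a`, which no thin cut can separate.
    have hde : ¬ G.Adj d e := fun h ↦ by
      have hed := h.symm
      have h1 := hS.mem_iff_of_triangle hab hbc hca
      have h2 := hS.mem_iff_of_triangle hbc hca hab
      have h3 := hS.mem_iff_of_triangle had h hea
      have h4 := hS.mem_iff_of_triangle h hea had
      have hall : ∀ v, v ∈ S ↔ a ∈ S := fun v ↦ by
        rcases hV v with h | h | h | h | h <;> rw [h]
        exacts [h1.symm, (h1.trans h2).symm, h3.symm, (h3.trans h4).symm]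
      exact hy ((hall y).2 ((hall x).1 hx))
    refine Or.inl ⟨a, b, c, hab.ne', hca.ne, hbc.ne, ?_⟩
    clear hS h4 hb he
    ext u v
    rw [sup_adj, starGraph_adj, edge_adj]
    rcases hV u with rfl | rfl | rfl | rfl | rfl <;> rcases hV v with rfl | rfl | rfl | rfl | rfl <;>
      grind [G.adj_comm, G.irrefl]
  by_cases hbe : G.Adj b e
  · have hce : ¬ G.Adj c e := fun h ↦
      h4 b e c a (nodup_four.2 (by grind)) hbe h.symm hca hab
    have hde : ¬ G.Adj d e := fun h ↦
      h4 a d e b (nodup_four.2 (by grind)) had h hbe.symm hba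
    right; right; left
    refine nonempty_iso_of_nodup_five hc hd ?_ ?_ ?_ ?_ <;>
      simp [bull, hab, hac, had, hae, hbc, hbd, hbe, hcd, hce, hde]
  by_cases hce : G.Adj c e
  · have hde : ¬ G.Adj d e := fun h ↦
      h4 a d e c (nodup_four.2 (by grind)) had h hce.symm hca
    right; right; left
    refine nonempty_iso_of_nodup_five hc (a := a) (b := c) (c := b) (d := d) (e := e)
      (nodup_five.2 (by grind)) ?_ ?_ ?_ ?_ <;>
      simp [bull, hab, hac, had, hae, hcb, hbd, hbe, hcd, hce, hde]
  have hde : G.Adj d e := by tauto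
  refine Or.inr (Or.inl ⟨a, d, b, c, e, nodup_five.2 (by grind), ?_⟩)
  clear hS h4 hb he
  ext u v
  simp only [doubleStar, sup_adj, fromRel_adj, edge_adj]
  have := hde.symm
  rcases hV u with rfl | rfl | rfl | rfl | rfl <;> rcases hV v with rfl | rfl | rfl | rfl | rfl <;>
    grind [G.adj_comm, G.irrefl]

lemma isBridgedOrderFive [Fintype V] (hG : G.Connected) (hc : Fintype.card V = 5)
    (ha : ¬ G.IsAcyclic) (hb : ¬ G.IsEdgeConnected 2) : IsBridgedOrderFive G := by
  by_cases h4 : ∀ a b c d, [a, b, c, d].Nodup → G.Adj a b → G.Adj b c → G.Adj c d → ¬ G.Adj d a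
  · obtain ⟨m, hm, f, hf⟩ := exists_embeds_cycleEdges ha
    have hm5 := hf.card_le
    rcases (by omega : m = 3 ∨ m = 4 ∨ m = 5) with rfl | rfl | rfl
    · obtain ⟨i, hi, x, h1⟩ := hf.exists_cons hG (by norm_num) (by omega)
      obtain ⟨j, hj, y, h2⟩ := h1.exists_cons hG (by norm_num) (by omega)
      set g := Function.update (Function.update f 3 x) 4 y
      have hnd : [g 0, g 1, g 2, g 3, g 4].Nodup := h2.nodup_map
      have h01 : G.Adj (g 0) (g 1) := (h2.adj (0, 1) (by simp [cycleEdges, List.range_succ])).2.2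
      have h12 : G.Adj (g 1) (g 2) := (h2.adj (1, 2) (by simp [cycleEdges, List.range_succ])).2.2
      have h20 : G.Adj (g 2) (g 0) := (h2.adj (2, 0) (by simp [cycleEdges, List.range_succ])).2.2
      have hi3 : G.Adj (g i) (g 3) := (h2.adj (i, 3) (by simp)).2.2
      have hj4 : G.Adj (g j) (g 4) := (h2.adj (j, 4) (by simp)).2.2
      replace hj4 : G.Adj (g 0) (g 4) ∨ G.Adj (g 1) (g 4) ∨ G.Adj (g 2) (g 4) ∨
          G.Adj (g 3) (g 4) := by
        interval_cases j <;> simp [hj4]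
      rw [nodup_five] at hnd
      interval_cases i
      · exact isBridgedOrderFive_of_triangle hc hb h4 (a := g 0) (b := g 1) (c := g 2)
          (d := g 3) (e := g 4) (nodup_five.2 (by grind)) h01 h12 h20 hi3 (by tauto)
      · exact isBridgedOrderFive_of_triangle hc hb h4 (a := g 1) (b := g 2) (c := g 0)
          (d := g 3) (e := g 4) (nodup_five.2 (by grind)) h12 h20 h01 hi3 (by tauto)
      · exact isBridgedOrderFive_of_triangle hc hb h4 (a := g 2) (b := g 0) (c := g 1)
          (d := g 3) (e := g 4) (nodup_five.2 (by grind)) h20 h01 h12 hi3 (by tauto)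
    · have hnd : [f 0, f 1, f 2, f 3].Nodup := hf.nodup_map
      have hadj (i j : ℕ) (h : (i, j) ∈ cycleEdges 4) := (hf.adj (i, j) h).2.2
      exact absurd (hadj 3 0 (by decide)) (h4 _ _ _ _ hnd (hadj 0 1 (by decide))
        (hadj 1 2 (by decide)) (hadj 2 3 (by decide)))
    · have hnd : [f 0, f 1, f 2, f 3, f 4].Nodup := hf.nodup_map
      have hadj (i j : ℕ) (h : (i, j) ∈ cycleEdges 5) := (hf.adj (i, j) h).2.2
      have h01 := hadj 0 1 (by decide)
      have h12 := hadj 1 2 (by decide)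
      have h23 := hadj 2 3 (by decide)
      have h34 := hadj 3 4 (by decide)
      have h40 := hadj 4 0 (by decide)
      obtain ⟨S, ⟨x, hx⟩, ⟨y, hy⟩, hS⟩ := exists_isThinCut hb
      have hV := mem_of_nodup_of_length hnd hc
      simp only [List.mem_cons, List.not_mem_nil, or_false] at hV
      rw [nodup_five] at hnd
      -- One implication per edge suffices: going around the cycle supplies the converses.
      have h1 := hS.mem_of_five_cycle (by grind) (by grind) (by grind) h01 h12 h23 h34 h40
      have h2 := hS.mem_of_five_cycle (by grind) (by grind) (by grind) h12 h23 h34 h40 h01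
      have h3 := hS.mem_of_five_cycle (by grind) (by grind) (by grind) h23 h34 h40 h01 h12
      have h4 := hS.mem_of_five_cycle (by grind) (by grind) (by grind) h34 h40 h01 h12 h23
      have h5 := hS.mem_of_five_cycle (by grind) (by grind) (by grind) h40 h01 h12 h23 h34
      have hall : ∀ v, v ∈ S ↔ f 0 ∈ S := fun v ↦ by
        rcases hV v with h | h | h | h | h <;> rw [h]
        exacts [⟨fun h ↦ h5 (h4 (h3 (h2 h))), h1⟩, ⟨fun h ↦ h5 (h4 (h3 h)), fun h ↦ h2 (h1 h)⟩,
          ⟨fun h ↦ h5 (h4 h), fun h ↦ h3 (h2 (h1 h))⟩, ⟨h5, fun h ↦ h4 (h3 (h2 (h1 h)))⟩]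
      exact absurd ((hall y).2 ((hall x).1 hx)) hy
  · push Not at h4
    obtain ⟨a, b, c, d, hd, hab, hbc, hcd, hda⟩ := h4
    have hd' := nodup_four.1 hd
    obtain ⟨p, hp⟩ : ∃ p, p ∉ [a, b, c, d] := by
      by_contra! hall
      classical
      have h1 : [a, b, c, d].toFinset = Finset.univ :=
        Finset.eq_univ_iff_forall.2 fun v ↦ List.mem_toFinset.2 (hall v)
      have h2 := List.toFinset_card_of_nodup hd
      rw [h1, Finset.card_univ, hc] at h2
      simp at h2
    have hp' := hp
    simp only [List.mem_cons, List.not_mem_nil, or_false, not_or] at hp'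
    obtain ⟨s, hs, v, hv, hsv⟩ := hG.exists_adj_boundary (S := {v | v ∈ [a, b, c, d]}) (x := a)
      (by simp) hp
    have hvp : v = p := by
      have := mem_of_nodup_of_length (l := [a, b, c, d, p]) (nodup_five.2 (by grind)) hc v
      simp only [Set.mem_ofPred_eq, List.mem_cons, List.not_mem_nil, or_false, not_or] at this hv
      tauto
    subst hvp
    simp only [Set.mem_ofPred_eq, List.mem_cons, List.not_mem_nil, or_false] at hs
    rcases hs with rfl | rfl | rfl | rfl
    · exact isBridgedOrderFive_of_four_cycle hc hb (nodup_five.2 (by grind)) hab hbc hcd hda hsv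
    · exact isBridgedOrderFive_of_four_cycle hc hb (nodup_five.2 (by grind)) hbc hcd hda hab hsv
    · exact isBridgedOrderFive_of_four_cycle hc hb (nodup_five.2 (by grind)) hcd hda hab hbc hsv
    · exact isBridgedOrderFive_of_four_cycle hc hb (nodup_five.2 (by grind)) hda hab hbc hcd hsv

/-! ### Trees -/

lemma nodup_seven {a b c d e f g : V} : [a, b, c, d, e, f, g].Nodup ↔
    (a ≠ b ∧ a ≠ c ∧ a ≠ d ∧ a ≠ e ∧ a ≠ f ∧ a ≠ g) ∧ (b ≠ c ∧ b ≠ d ∧ b ≠ e ∧ b ≠ f ∧ b ≠ g) ∧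
    (c ≠ d ∧ c ≠ e ∧ c ≠ f ∧ c ≠ g) ∧ (d ≠ e ∧ d ≠ f ∧ d ≠ g) ∧ (e ≠ f ∧ e ≠ g) ∧ f ≠ g := by
  simp

lemma nodup_eight {a b c d e f g h : V} : [a, b, c, d, e, f, g, h].Nodup ↔
    (a ≠ b ∧ a ≠ c ∧ a ≠ d ∧ a ≠ e ∧ a ≠ f ∧ a ≠ g ∧ a ≠ h) ∧
    (b ≠ c ∧ b ≠ d ∧ b ≠ e ∧ b ≠ f ∧ b ≠ g ∧ b ≠ h) ∧
    (c ≠ d ∧ c ≠ e ∧ c ≠ f ∧ c ≠ g ∧ c ≠ h) ∧ (d ≠ e ∧ d ≠ f ∧ d ≠ g ∧ d ≠ h) ∧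
    (e ≠ f ∧ e ≠ g ∧ e ≠ h) ∧ (f ≠ g ∧ f ≠ h) ∧ g ≠ h := by
  simp

lemma exists_adj_of_card_lt [Fintype V] (hG : G.Connected) {S : Finset V} (hS : S.Nonempty)
    (hc : S.card < Fintype.card V) : ∃ s ∈ S, ∃ v ∉ S, G.Adj s v := by
  obtain ⟨x, hx⟩ := hS
  obtain ⟨y, -, hy⟩ := Finset.exists_mem_notMem_of_card_lt_card (hc.trans_eq Finset.card_univ.symm)
  exact hG.exists_adj_boundary (S := S) hx hy

lemma exists_mem_of_length_lt {S : Finset V} {l : List V} (h : l.length < S.card) :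
    ∃ v ∈ S, v ∉ l := by
  classical
  obtain ⟨v, hv, hv'⟩ := Finset.exists_mem_notMem_of_card_lt_card
    ((List.toFinset_card_le l).trans_lt h)
  exact ⟨v, hv, by simpa using hv'⟩

/-- The tree with root `0`, children `1`, `2`, `3` of the root and further vertices `4`, `5`, `6`
attached to `1`, `i`, `j`. -/
def rootedEdges (i j : ℕ) : List (ℕ × ℕ) := [(j, 6), (i, 5), (1, 4), (0, 1), (0, 2), (0, 3)]

/-- The exceptions need four colors: `(1, 1)` gives vertex `1` degree four, and `(4, 4)` is the
forked tree with middle vertex `1`. The value `i = 3` is omitted, being symmetric to `i = 2`. -/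
lemma colorable_rootedEdges : ∀ i ∈ [1, 2, 4], ∀ j ∈ [1, 2, 3, 4, 5],
    (i = 1 ∧ j = 1) ∨ (i = 4 ∧ j = 4) ∨ colorable (rootedEdges i j) 7 3
      [[0, 0, 1, 2, 1, 0], [0, 1, 0, 2, 0, 1], [0, 1, 0, 1, 2, 0], [0, 1, 2, 0, 2, 1]] = true := by
  decide +kernel

lemma cfc_add_four_le_of_rooted [Fintype V] (hG : G.Connected)
    {w u₁ u₂ u₃ v₁ v₂ v₃ : V} (hl : [w, u₁, u₂, u₃, v₁, v₂, v₃].Nodup) (h₁ : G.Adj w u₁)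
    (h₂ : G.Adj w u₂) (h₃ : G.Adj w u₃) (hv₁ : G.Adj u₁ v₁) (i j : ℕ)
    (hv₂ : G.Adj ([w, u₁, u₂, u₃, v₁, v₂, v₃].getD i w) v₂)
    (hv₃ : G.Adj ([w, u₁, u₂, u₃, v₁, v₂, v₃].getD j w) v₃)
    (hi : i ∈ [1, 2, 4] := by simp) (hj : j ∈ [1, 2, 3, 4, 5] := by simp)
    (h11 : ¬ (i = 1 ∧ j = 1) := by norm_num) (h44 : ¬ (i = 4 ∧ j = 4) := by norm_num) :
    cfc G + 4 ≤ Fintype.card V := by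
  have hc := ((colorable_rootedEdges i hi j hj).resolve_left h11).resolve_left h44
  have hi' : i < 7 := by revert hi; simp; omega
  have hj' : j < 7 := by revert hj; simp; omega
  have := cfc_add_le_of_list hG w hl (m := 7) rfl (E := rootedEdges i j) ?_ _ hc
  · omega
  · simp only [rootedEdges, List.forall_mem_cons, List.length_cons, List.length_nil]
    refine ⟨⟨by omega, by omega, hv₃⟩, ⟨by omega, by omega, hv₂⟩, ?_⟩
    simp [*]

/-- A connected graph with a vertex `w` of degree between `3` and `n - 4` satisfies
`cfc G ≤ n - 4`, unless it contains one of two special subtrees. -/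
lemma cfc_add_four_le_or_exists [Fintype V] [DecidableRel G.Adj] (hG : G.Connected) {w : V}
    (h3 : 3 ≤ G.degree w) (hn : G.degree w + 4 ≤ Fintype.card V) :
    cfc G + 4 ≤ Fintype.card V ∨ ∃ u v₁ v₂ v₃, G.Adj w u ∧ [w, u, v₁, v₂, v₃].Nodup ∧
      (¬ G.Adj w v₁ ∧ ¬ G.Adj w v₂ ∧ ¬ G.Adj w v₃) ∧ G.Adj u v₁ ∧
      ((G.Adj u v₂ ∧ G.Adj u v₃) ∨ (G.Adj v₁ v₂ ∧ G.Adj v₁ v₃)) := by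
  classical
  have hmem (v : V) : v ∈ G.neighborFinset w ↔ G.Adj w v := G.mem_neighborFinset w v
  have hcard : (G.neighborFinset w).card = G.degree w := G.card_neighborFinset_eq_degree w
  have hS : (insert w (G.neighborFinset w)).card ≤ G.degree w + 1 :=
    hcard ▸ Finset.card_insert_le _ _
  -- The closed neighborhood of `w` misses at least three vertices, so the growing set can be left
  -- three times. The cases below record where `v₂` and `v₃` attach.
  obtain ⟨s₁, hs₁, v₁, hv₁, h₁⟩ := exists_adj_of_card_lt hG
    (S := insert w (G.neighborFinset w)) (Finset.insert_nonempty _ _) (by omega)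
  have hS' := Finset.card_insert_le v₁ (insert w (G.neighborFinset w))
  obtain ⟨s₂, hs₂, v₂, hv₂, h₂⟩ := exists_adj_of_card_lt hG
    (S := insert v₁ (insert w (G.neighborFinset w))) (Finset.insert_nonempty _ _) (by omega)
  have hS'' := Finset.card_insert_le v₂ (insert v₁ (insert w (G.neighborFinset w)))
  obtain ⟨s₃, hs₃, v₃, hv₃, h₃⟩ := exists_adj_of_card_lt hG
    (S := insert v₂ (insert v₁ (insert w (G.neighborFinset w))))
    (Finset.insert_nonempty _ _) (by omega)
  simp only [Finset.mem_insert, hmem, not_or] at hs₁ hv₁ hs₂ hv₂ hs₃ hv₃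
  have hs₁' : G.Adj w s₁ := hs₁.resolve_left fun h ↦ hv₁.2 (h ▸ h₁)
  have hs₂w : s₂ ≠ w := fun h ↦ hv₂.2.2 (h ▸ h₂)
  have hs₃w : s₃ ≠ w := fun h ↦ hv₃.2.2.2 (h ▸ h₃)
  have hs₁w := hs₁'.ne'
  -- Supplies further children of the root `w` when the attaching vertices provide fewer than three.
  have hthird (a b : V) : ∃ t, G.Adj w t ∧ t ≠ a ∧ t ≠ b ∧ t ≠ w := by
    obtain ⟨t, ht, htl⟩ := exists_mem_of_length_lt (S := G.neighborFinset w) (l := [a, b])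
      (by simp; omega)
    rw [hmem] at ht
    exact ⟨t, ht, by simp at htl; tauto, by simp at htl; tauto, ht.ne'⟩
  have hnd : [w, s₁, v₁, v₂, v₃].Nodup := nodup_five.2 (by grind)
  rcases hs₂ with rfl | hs₂ | hs₂
  · rcases hs₃ with rfl | rfl | hs₃ | hs₃
    · obtain ⟨t, ht, ht1, -, htw⟩ := hthird s₁ s₁
      obtain ⟨t', ht', ht1', htt', htw'⟩ := hthird s₁ t
      exact Or.inl (cfc_add_four_le_of_rooted hG (u₂ := t) (u₃ := t') (nodup_seven.2 (by grind))
        hs₁' ht ht' h₁ 4 5 h₂ h₃)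
    · exact Or.inr ⟨s₁, s₃, v₂, v₃, hs₁', hnd, ⟨hv₁.2, hv₂.2.2, hv₃.2.2.2⟩, h₁, Or.inr ⟨h₂, h₃⟩⟩
    · exact absurd hs₃ hs₃w
    · by_cases h31 : s₃ = s₁
      · subst h31
        obtain ⟨t, ht, ht1, -, htw⟩ := hthird s₃ s₃
        obtain ⟨t', ht', ht1', htt', htw'⟩ := hthird s₃ t
        exact Or.inl (cfc_add_four_le_of_rooted hG (u₂ := t) (u₃ := t')
          (nodup_seven.2 (by grind)) hs₁' ht ht' h₁ 4 1 h₂ h₃)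
      · obtain ⟨t, ht, ht1, htt, htw⟩ := hthird s₁ s₃
        exact Or.inl (cfc_add_four_le_of_rooted hG (u₂ := s₃) (u₃ := t)
          (nodup_seven.2 (by grind)) hs₁' hs₃ ht h₁ 4 2 h₂ h₃)
  · exact absurd hs₂ hs₂w
  · by_cases h21 : s₂ = s₁
    · subst h21
      obtain ⟨t, ht, ht1, -, htw⟩ := hthird s₂ s₂
      obtain ⟨t', ht', ht1', htt', htw'⟩ := hthird s₂ t
      rcases hs₃ with rfl | rfl | hs₃ | hs₃
      · exact Or.inl (cfc_add_four_le_of_rooted hG (u₂ := t) (u₃ := t')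
          (nodup_seven.2 (by grind)) hs₁' ht ht' h₁ 1 5 h₂ h₃)
      · exact Or.inl (cfc_add_four_le_of_rooted hG (u₂ := t) (u₃ := t')
          (nodup_seven.2 (by grind)) hs₁' ht ht' h₁ 1 4 h₂ h₃)
      · exact absurd hs₃ hs₃w
      · by_cases h31 : s₃ = s₂
        · subst h31
          exact Or.inr ⟨s₃, v₁, v₂, v₃, hs₁', hnd, ⟨hv₁.2, hv₂.2.2, hv₃.2.2.2⟩, h₁,
            Or.inl ⟨h₂, h₃⟩⟩
        · obtain ⟨t, ht, ht1, htt, htw⟩ := hthird s₂ s₃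
          exact Or.inl (cfc_add_four_le_of_rooted hG (u₂ := s₃) (u₃ := t)
            (nodup_seven.2 (by grind)) hs₁' hs₃ ht h₁ 1 2 h₂ h₃)
    · obtain ⟨t, ht, ht1, htt, htw⟩ := hthird s₁ s₂
      rcases hs₃ with rfl | rfl | hs₃ | hs₃
      · exact Or.inl (cfc_add_four_le_of_rooted hG (u₂ := s₂) (u₃ := t)
          (nodup_seven.2 (by grind)) hs₁' hs₂ ht h₁ 2 5 h₂ h₃)
      · exact Or.inl (cfc_add_four_le_of_rooted hG (u₂ := s₂) (u₃ := t)
          (nodup_seven.2 (by grind)) hs₁' hs₂ ht h₁ 2 4 h₂ h₃)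
      · exact absurd hs₃ hs₃w
      · by_cases h31 : s₃ = s₁
        · subst h31
          exact Or.inl (cfc_add_four_le_of_rooted hG (u₂ := s₂) (u₃ := t)
            (nodup_seven.2 (by grind)) hs₁' hs₂ ht h₁ 2 1 h₂ h₃)
        by_cases h32 : s₃ = s₂
        · subst h32
          exact Or.inl (cfc_add_four_le_of_rooted hG (u₂ := s₃) (u₃ := t)
            (nodup_seven.2 (by grind)) hs₁' hs₂ ht h₁ 2 2 h₂ h₃)
        · exact Or.inl (cfc_add_four_le_of_rooted hG (u₂ := s₂) (u₃ := s₃)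
            (nodup_seven.2 (by grind)) hs₁' hs₂ hs₃ h₁ 2 3 h₂ h₃)

/-- A connected graph with a vertex of degree `n - 3 ≥ 3` satisfies `cfc G ≤ n - 3`. -/
lemma cfc_add_three_le_of_degree [Fintype V] [DecidableRel G.Adj] (hG : G.Connected) {w : V}
    (h3 : 3 ≤ G.degree w) (hn : G.degree w + 3 = Fintype.card V) :
    cfc G + 3 ≤ Fintype.card V := by
  classical
  have hmem (v : V) : v ∈ G.neighborFinset w ↔ G.Adj w v := G.mem_neighborFinset w v
  have hcard : (G.neighborFinset w).card = G.degree w := G.card_neighborFinset_eq_degree w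
  have hS : (insert w (G.neighborFinset w)).card ≤ G.degree w + 1 :=
    hcard ▸ Finset.card_insert_le _ _
  obtain ⟨s₁, hs₁, v₁, hv₁, h₁⟩ := exists_adj_of_card_lt hG
    (S := insert w (G.neighborFinset w)) (Finset.insert_nonempty _ _) (by omega)
  have hS' := Finset.card_insert_le v₁ (insert w (G.neighborFinset w))
  obtain ⟨s₂, hs₂, v₂, hv₂, h₂⟩ := exists_adj_of_card_lt hG
    (S := insert v₁ (insert w (G.neighborFinset w))) (Finset.insert_nonempty _ _) (by omega)
  simp only [Finset.mem_insert, hmem, not_or] at hs₁ hv₁ hs₂ hv₂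
  have hs₁' : G.Adj w s₁ := hs₁.resolve_left fun h ↦ hv₁.2 (h ▸ h₁)
  have hs₂w : s₂ ≠ w := fun h ↦ hv₂.2.2 (h ▸ h₂)
  have hs₁w := hs₁'.ne'
  have hthird (a b : V) : ∃ t, G.Adj w t ∧ t ≠ a ∧ t ≠ b ∧ t ≠ w := by
    obtain ⟨t, ht, htl⟩ := exists_mem_of_length_lt (S := G.neighborFinset w) (l := [a, b])
      (by simp; omega)
    rw [hmem] at ht
    exact ⟨t, ht, by simp at htl; tauto, by simp at htl; tauto, ht.ne'⟩
  have key (u₂ u₃ : V) (hl : [w, s₁, u₂, u₃, v₁, v₂].Nodup) (h2 : G.Adj w u₂) (h3 : G.Adj w u₃)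
      (i : ℕ) (hi : i ∈ [1, 2, 4]) (h : G.Adj ([w, s₁, u₂, u₃, v₁, v₂].getD i w) v₂) :
      cfc G + 3 ≤ Fintype.card V := by
    have hc : ∀ i ∈ [1, 2, 4], colorable [(i, 5), (1, 4), (0, 1), (0, 2), (0, 3)] 6 3
        [[0, 1, 2, 1, 0]] = true := by decide +kernel
    have hi' : i < 6 := by revert hi; simp; omega
    have := cfc_add_le_of_list hG w hl (m := 6) rfl ?_ _ (hc i hi)
    · omega
    · simp only [List.forall_mem_cons, List.length_cons, List.length_nil]
      refine ⟨⟨by omega, by omega, h⟩, ?_⟩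
      simp [*]
  rcases hs₂ with rfl | hs₂ | hs₂
  · obtain ⟨t, ht, ht1, -, htw⟩ := hthird s₁ s₁
    obtain ⟨t', ht', ht1', htt', htw'⟩ := hthird s₁ t
    exact key t t' (nodup_six.2 (by grind)) ht ht' 4 (by simp) h₂
  · exact absurd hs₂ hs₂w
  · by_cases h21 : s₂ = s₁
    · subst h21
      obtain ⟨t, ht, ht1, -, htw⟩ := hthird s₂ s₂
      obtain ⟨t', ht', ht1', htt', htw'⟩ := hthird s₂ t
      exact key t t' (nodup_six.2 (by grind)) ht ht' 1 (by simp) h₂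
    · obtain ⟨t, ht, ht1, htt, htw⟩ := hthird s₁ s₂
      exact key s₂ t (nodup_six.2 (by grind)) hs₂ ht 2 (by simp) h₂

/-- Counting edges: `H` sits inside a tree of the same order and already has `m - 1` edges, so
checking one inclusion is enough. -/
lemma nonempty_iso_of_isTree [Fintype V] (hG : G.IsTree) {m : ℕ} {H : SimpleGraph (Fin m)}
    {E : Finset (Sym2 (Fin m))} (hH : H.edgeSet = E) (hE : E.card + 1 = m)
    (hc : Fintype.card V = m) {f : Fin m → V} (hf : Function.Injective f)
    (h : ∀ i j, H.Adj i j → G.Adj (f i) (f j)) : Nonempty (G ≃g H) := by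
  classical
  have hb : Function.Bijective f :=
    (Fintype.bijective_iff_injective_and_card f).2 ⟨hf, by simp [hc]⟩
  let φ : G.comap f ≃g G := ⟨Equiv.ofBijective f hb, Iff.rfl⟩
  have hle : H ≤ G.comap f := fun i j hij ↦ h i j hij
  have h1 := hG.card_edgeFinset
  rw [← φ.card_edgeFinset_eq, hc] at h1
  have h2 : H.edgeFinset = (G.comap f).edgeFinset := by
    refine Finset.eq_of_subset_of_card_le (edgeFinset_subset_edgeFinset.2 hle) ?_
    have : H.edgeFinset = E := Finset.coe_injective (by rw [coe_edgeFinset, hH])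
    rw [this]
    omega
  rw [edgeFinset_inj.1 h2]
  exact ⟨φ.symm⟩

lemma isTree_of_iso [Fintype V] (hG : G.Connected) {m : ℕ} {H : SimpleGraph (Fin m)}
    {E : Finset (Sym2 (Fin m))} (hH : H.edgeSet = E) (hE : E.card + 1 = m)
    (φ : G ≃g H) : G.IsTree := by
  classical
  rw [isTree_iff_connected_and_card]
  refine ⟨hG, ?_⟩
  rw [Nat.card_congr φ.toEquiv, Nat.card_fin, Nat.card_congr φ.mapEdgeSet, hH]
  simpa using hE

lemma edgeSet_fromEdgeSet_of_finset {m : ℕ} {E : Finset (Sym2 (Fin m))}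
    (hE : ∀ e ∈ E, ¬ e.IsDiag) : (fromEdgeSet (E : Set (Sym2 (Fin m)))).edgeSet = E := by
  rw [edgeSet_fromEdgeSet]
  exact sdiff_eq_left.2 (Set.disjoint_left.2 hE)

lemma edgeSet_forkedTree : forkedTree.edgeSet =
    ({s(0, 1), s(0, 2), s(1, 3), s(1, 4), s(2, 5), s(2, 6)} : Finset (Sym2 (Fin 7))) := by
  rw [← edgeSet_fromEdgeSet_of_finset (by decide)]
  simp [forkedTree]

lemma edgeSet_pathGraph_six : (pathGraph 6).edgeSet =
    ({s(0, 1), s(1, 2), s(2, 3), s(3, 4), s(4, 5)} : Finset (Sym2 (Fin 6))) := by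
  ext e
  induction e with
  | h x y =>
    rw [mem_edgeSet, pathGraph_adj]
    revert x y
    decide

lemma nonempty_iso_forkedTree [Fintype V] (hG : G.IsTree) (hc : Fintype.card V = 7)
    {m a b x₁ x₂ y₁ y₂ : V} (hl : [m, a, b, x₁, x₂, y₁, y₂].Nodup) (hma : G.Adj m a)
    (hmb : G.Adj m b) (hx₁ : G.Adj a x₁) (hx₂ : G.Adj a x₂) (hy₁ : G.Adj b y₁)
    (hy₂ : G.Adj b y₂) : Nonempty (G ≃g forkedTree) := by
  refine nonempty_iso_of_isTree hG edgeSet_forkedTree (by decide) hc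
    (f := ![m, a, b, x₁, x₂, y₁, y₂]) (List.nodup_ofFn.1 (by simpa using hl)) fun i j hij ↦ ?_
  have : s(i, j) ∈ forkedTree.edgeSet := hij
  rw [edgeSet_forkedTree] at this
  simp only [Finset.coe_insert, Finset.coe_singleton, Set.mem_insert_iff, Set.mem_singleton_iff,
    Sym2.eq_iff] at this
  have := hma.symm
  have := hmb.symm
  have := hx₁.symm
  have := hx₂.symm
  have := hy₁.symm
  have := hy₂.symm
  rcases ‹_ ∨ _› with (⟨rfl, rfl⟩ | ⟨rfl, rfl⟩) | (⟨rfl, rfl⟩ | ⟨rfl, rfl⟩) |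
    (⟨rfl, rfl⟩ | ⟨rfl, rfl⟩) | (⟨rfl, rfl⟩ | ⟨rfl, rfl⟩) | (⟨rfl, rfl⟩ | ⟨rfl, rfl⟩) |
    (⟨rfl, rfl⟩ | ⟨rfl, rfl⟩) <;> assumption

/-- While vertices remain, one is adjacent to the path. It attaches at an end, because an inner
vertex already has its two neighbors. -/
lemma exists_path_of_degree_le_two [Fintype V] [DecidableRel G.Adj] (hG : G.Connected)
    (hd : ∀ v, G.degree v ≤ 2) {k : ℕ} (hk : 1 ≤ k) (hkn : k ≤ Fintype.card V) :
    ∃ f : ℕ → V, Set.InjOn f (Set.Iio k) ∧ ∀ i, i + 1 < k → G.Adj (f i) (f (i + 1)) := by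
  classical
  induction k, hk using Nat.le_induction with
  | base =>
    obtain ⟨v⟩ := hG.nonempty
    exact ⟨fun _ ↦ v, fun a ha b hb _ ↦ by simp at ha hb; omega, by omega⟩
  | succ k hk ih =>
    obtain ⟨f, hf, hadj⟩ := ih (by omega)
    obtain ⟨s, hs, v, hv, hsv⟩ := exists_adj_of_card_lt hG (S := (Finset.range k).image f)
      ⟨f 0, Finset.mem_image_of_mem f (Finset.mem_range.2 hk)⟩
      (Finset.card_image_le.trans_lt (by simpa using hkn))
    obtain ⟨i, hi, rfl⟩ := Finset.mem_image.1 hs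
    rw [Finset.mem_range] at hi
    have hv' : ∀ j < k, f j ≠ v := fun j hj hjv ↦
      hv (hjv ▸ Finset.mem_image_of_mem f (Finset.mem_range.2 hj))
    by_cases hik : i + 1 = k
    · refine ⟨Function.update f k v, fun a ha b hb hab ↦ ?_, fun j hj ↦ ?_⟩
      · simp only [Set.mem_Iio, Nat.lt_succ_iff_lt_or_eq] at ha hb
        rcases ha with ha | rfl <;> rcases hb with hb | rfl
        · rw [Function.update_of_ne ha.ne, Function.update_of_ne hb.ne] at hab
          exact hf ha hb hab
        · rw [Function.update_of_ne ha.ne, Function.update_self] at hab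
          exact absurd hab (hv' a ha)
        · rw [Function.update_self, Function.update_of_ne hb.ne] at hab
          exact absurd hab.symm (hv' b hb)
        · rfl
      · rw [Function.update_of_ne (by omega)]
        by_cases hjk : j + 1 = k
        · obtain rfl : j = i := by omega
          rwa [hjk, Function.update_self]
        · rw [Function.update_of_ne hjk]
          exact hadj j (by omega)
    by_cases hi0 : i = 0
    · subst hi0
      -- At the initial end, the old path is shifted by one to make room for `v`.
      refine ⟨fun j ↦ if j = 0 then v else f (j - 1), fun a ha b hb hab ↦ ?_, fun j hj ↦ ?_⟩
      · simp only [Set.mem_Iio] at ha hb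
        by_cases ha0 : a = 0 <;> by_cases hb0 : b = 0 <;> simp only [ha0, hb0, if_true, if_false] at hab
        · omega
        · exact absurd hab.symm (hv' _ (by omega))
        · exact absurd hab (hv' _ (by omega))
        · have := hf (Set.mem_Iio.2 (by omega)) (Set.mem_Iio.2 (by omega)) hab
          omega
      · rcases j with _ | j
        · simpa using hsv.symm
        · simpa using hadj j (by omega)
    · exfalso
      have h1 := hadj (i - 1) (by omega)
      have h2 := hadj i (by omega)
      rw [Nat.sub_add_cancel (by omega)] at h1
      have hsub : ({f (i - 1), f (i + 1), v} : Finset V) ⊆ G.neighborFinset (f i) := by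
        intro x hx
        simp only [Finset.mem_insert, Finset.mem_singleton] at hx
        rw [mem_neighborFinset]
        rcases hx with rfl | rfl | rfl
        exacts [h1.symm, h2, hsv]
      have h3 := Finset.card_le_card hsub
      rw [card_neighborFinset_eq_degree, Finset.card_eq_three.2 ⟨_, _, _, ?_, ?_, ?_, rfl⟩] at h3
      · exact absurd (hd (f i)) (by omega)
      · intro h
        have := hf (Set.mem_Iio.2 (by omega)) (Set.mem_Iio.2 (by omega)) h
        omega
      · exact hv' _ (by omega)
      · exact hv' _ (by omega)

lemma cfc_add_four_le_of_degree_le_two [Fintype V] [DecidableRel G.Adj] (hG : G.Connected)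
    (hd : ∀ v, G.degree v ≤ 2) (hn : 7 ≤ Fintype.card V) : cfc G + 4 ≤ Fintype.card V := by
  obtain ⟨f, hf, hadj⟩ := exists_path_of_degree_le_two hG hd (by norm_num) hn
  have h : Embeds G [(0, 1), (1, 2), (2, 3), (3, 4), (4, 5), (5, 6)] 7 f := by
    refine ⟨hf, ?_⟩
    simp [hadj]
  have := h.cfc_add_le hG (k := 3) [[0, 1, 0, 2, 0, 1]] (by decide +kernel)
  omega

lemma three_le_cfc_of_degree_le_two [Fintype V] [DecidableRel G.Adj] (hG : G.Connected)
    (ha : G.IsAcyclic) (hd : ∀ v, G.degree v ≤ 2) (hn : 5 ≤ Fintype.card V) : 3 ≤ cfc G := by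
  obtain ⟨f, hf, hadj⟩ := exists_path_of_degree_le_two hG hd (by norm_num) hn
  have h : Embeds G [] 5 f := ⟨hf, by simp⟩
  exact three_le_cfc_of_isAcyclic hG ha h.nodup_map (hadj 0 (by norm_num)) (hadj 1 (by norm_num))
    (hadj 2 (by norm_num)) (hadj 3 (by norm_num))

lemma nonempty_iso_pathGraph_six [Fintype V] [DecidableRel G.Adj] (hG : G.IsTree)
    (hd : ∀ v, G.degree v ≤ 2) (hn : Fintype.card V = 6) : Nonempty (G ≃g pathGraph 6) := by
  obtain ⟨f, hf, hadj⟩ := exists_path_of_degree_le_two hG.connected hd (k := 6) (by norm_num) hn.ge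
  refine nonempty_iso_of_isTree hG edgeSet_pathGraph_six (by decide) hn (f := fun i ↦ f i)
    (fun i j hij ↦ Fin.ext (hf i.2 j.2 hij)) fun i j hij ↦ ?_
  rw [pathGraph_adj] at hij
  rcases hij with h | h
  · exact h ▸ hadj i (by omega)
  · exact (h ▸ hadj j (by omega)).symm

/-- A tree of order `n` and maximum degree between `3` and `n - 4` satisfies `cfc G ≤ n - 4`,
unless it is the forked tree of order seven. -/
lemma cfc_add_four_le_or_nonempty_iso_forkedTree [Fintype V] [DecidableRel G.Adj] (hG : G.IsTree)
    {w : V} (hmax : ∀ v, G.degree v ≤ G.degree w) (h3 : 3 ≤ G.degree w)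
    (hn : G.degree w + 4 ≤ Fintype.card V) :
    cfc G + 4 ≤ Fintype.card V ∨ Nonempty (G ≃g forkedTree) := by
  classical
  have hmem (v : V) : v ∈ G.neighborFinset w ↔ G.Adj w v := G.mem_neighborFinset w v
  have hcard (v : V) : (G.neighborFinset v).card = G.degree v := G.card_neighborFinset_eq_degree v
  have hfour {s p q r t : V} (hd : [p, q, r, t].Nodup) (hp : G.Adj s p) (hq : G.Adj s q)
      (hr : G.Adj s r) (ht : G.Adj s t) : 4 ≤ G.degree w := by
    refine le_trans ?_ (hmax s)
    have : [p, q, r, t].toFinset ⊆ G.neighborFinset s := fun x hx ↦ by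
      simp only [List.mem_toFinset, List.mem_cons, List.not_mem_nil, or_false] at hx
      rw [mem_neighborFinset]
      rcases hx with rfl | rfl | rfl | rfl <;> assumption
    have h := Finset.card_le_card this
    rwa [List.toFinset_card_of_nodup hd, hcard] at h
  have hnbr (l : List V) (hl : l.length < G.degree w) : ∃ t, G.Adj w t ∧ t ∉ l ∧ t ≠ w := by
    obtain ⟨t, ht, htl⟩ := exists_mem_of_length_lt (hl.trans_eq (hcard w).symm)
    exact ⟨t, (hmem t).1 ht, htl, ((hmem t).1 ht).ne'⟩
  rcases cfc_add_four_le_or_exists hG.connected h3 hn with h | ⟨u, v₁, v₂, v₃, hu, hd, hnv, h₁, h⟩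
  · exact Or.inl h
  have hd' := nodup_five.1 hd
  obtain ⟨a, hwa, ha, haw⟩ := hnbr [u] (by simp; omega)
  obtain ⟨b, hwb, hb, hbw⟩ := hnbr [u, a] (by simp; omega)
  simp only [List.mem_cons, List.not_mem_nil, or_false, not_or] at ha hb
  have hnd : [w, u, a, b, v₁, v₂, v₃].Nodup := nodup_seven.2 (by grind)
  by_cases h4 : 4 ≤ G.degree w
  -- Degree four allows an extra neighbor `c` of `w`. Both exceptional shapes become trees of order
  -- eight served by four colors, which again saves four.
  · left
    obtain ⟨c, hwc, hc, hcw⟩ := hnbr [u, a, b] (by simp; omega)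
    simp only [List.mem_cons, List.not_mem_nil, or_false, not_or] at hc
    have hnd : [w, u, a, b, v₁, v₂, v₃, c].Nodup := nodup_eight.2 (by grind)
    rcases h with ⟨h₂, h₃⟩ | ⟨h₂, h₃⟩
    · have := cfc_add_le_of_list hG.connected w hnd (m := 8) rfl (k := 4)
        (E := [(0, 1), (0, 2), (0, 3), (1, 4), (1, 5), (1, 6), (0, 7)]) (by simp [*])
        [[0, 1, 2, 1, 2, 3, 3]] (by decide +kernel)
      omega
    · have := cfc_add_le_of_list hG.connected w hnd (m := 8) rfl (k := 4)
        (E := [(0, 1), (0, 2), (0, 3), (1, 4), (4, 5), (4, 6), (0, 7)]) (by simp [*])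
        [[0, 1, 2, 1, 2, 3, 3]] (by decide +kernel)
      omega
  have hdw : G.degree w = 3 := by omega
  rcases h with ⟨h₂, h₃⟩ | ⟨h₂, h₃⟩
  · exact absurd (hfour (nodup_four.2 (by grind)) hu.symm h₁ h₂ h₃) h4
  have hN (t : V) (ht : G.Adj w t) : t = u ∨ t = a ∨ t = b := by
    by_contra hne
    push Not at hne
    exact h4 (hfour (s := w) (nodup_four.2 (by grind)) hu hwa hwb ht)
  rcases (by omega : Fintype.card V = 7 ∨ 7 < Fintype.card V) with h7 | h7
  · exact Or.inr (nonempty_iso_forkedTree hG h7 (m := u) (a := w) (b := v₁) (x₁ := a) (x₂ := b)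
      (y₁ := v₂) (y₂ := v₃) (nodup_seven.2 (by grind)) hu.symm h₁ hwa hwb h₂ h₃)
  left
  -- An eighth vertex `x` attaches to the forked tree. At `w` or `v₁` it would create degree four;
  -- anywhere else, `x` with `v₁` and one of `v₂`, `v₃` gives a non-exceptional rooted tree.
  obtain ⟨s, hs, x, hx, hsx⟩ := exists_adj_of_card_lt hG.connected
    (S := [w, u, a, b, v₁, v₂, v₃].toFinset) ⟨w, by simp⟩
    ((List.toFinset_card_le _).trans_lt h7)
  simp only [List.mem_toFinset, List.mem_cons, List.not_mem_nil, or_false, not_or] at hs hx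
  rcases hs with rfl | rfl | rfl | rfl | rfl | rfl | rfl
  · have := hN x hsx
    grind
  · exact cfc_add_four_le_of_rooted hG.connected (v₃ := x) (nodup_seven.2 (by grind)) hu hwa hwb h₁
      4 1 h₂ hsx
  · exact cfc_add_four_le_of_rooted hG.connected (v₃ := x) (nodup_seven.2 (by grind)) hu hwa hwb h₁
      4 2 h₂ hsx
  · exact cfc_add_four_le_of_rooted hG.connected (v₃ := x) (nodup_seven.2 (by grind)) hu hwa hwb h₁
      4 3 h₂ hsx
  · exact absurd (hfour (nodup_four.2 (by grind)) h₁.symm h₂ h₃ hsx) h4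
  · exact cfc_add_four_le_of_rooted hG.connected (v₃ := x) (nodup_seven.2 (by grind)) hu hwa hwb h₁
      4 5 h₂ hsx
  · exact cfc_add_four_le_of_rooted hG.connected (v₃ := x) (nodup_seven.2 (by grind)) hu hwa hwb h₁
      4 5 h₃ hsx

/-! ### Exact values of the sporadic graphs, and the classification of trees -/

lemma cfc_eq_three_of_iso_pathGraph_six [Fintype V] (hG : G.Connected)
    (φ : G ≃g pathGraph 6) : cfc G = 3 := by
  have hc : Fintype.card V = 6 := by simpa using Fintype.card_congr φ.toEquiv
  have ha := (isTree_of_iso hG edgeSet_pathGraph_six (by decide) φ).isAcyclic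
  have hadj (i j : Fin 6) (h : i.val + 1 = j.val) : G.Adj (φ.symm i) (φ.symm j) :=
    φ.symm.map_adj_iff.2 (pathGraph_adj.2 (Or.inl h))
  have hl : (List.ofFn φ.symm).Nodup := List.nodup_ofFn.2 φ.symm.injective
  have h1 := cfc_add_le_of_list hG (φ.symm 0) hl List.length_ofFn (k := 3)
    (E := [(0, 1), (1, 2), (2, 3), (3, 4), (4, 5)])
    (by simp [hadj]) [[0, 1, 0, 2, 0]] (by decide +kernel)
  have h2 := three_le_cfc_of_isAcyclic hG ha (v₀ := φ.symm 0) (v₁ := φ.symm 1) (v₂ := φ.symm 2)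
    (v₃ := φ.symm 3) (v₄ := φ.symm 4) (nodup_five.2 (by simp)) (hadj 0 1 rfl) (hadj 1 2 rfl)
    (hadj 2 3 rfl) (hadj 3 4 rfl)
  rw [hc] at h1
  omega

lemma cfc_eq_four_of_iso_forkedTree [Fintype V] (hG : G.Connected)
    (φ : G ≃g forkedTree) : cfc G = 4 := by
  have hc : Fintype.card V = 7 := by simpa using Fintype.card_congr φ.toEquiv
  have ha := (isTree_of_iso hG edgeSet_forkedTree (by decide) φ).isAcyclic
  have hadj (i j : Fin 7) (h : s(i, j) ∈ ({s(0, 1), s(0, 2), s(1, 3), s(1, 4), s(2, 5), s(2, 6)} :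
      Finset (Sym2 (Fin 7)))) : G.Adj (φ.symm i) (φ.symm j) := by
    refine φ.symm.map_adj_iff.2 ?_
    rw [← mem_edgeSet, edgeSet_forkedTree]
    exact h
  have hl : (List.ofFn φ.symm).Nodup := List.nodup_ofFn.2 φ.symm.injective
  have h1 := cfc_add_le_of_list hG (φ.symm 0) hl List.length_ofFn (k := 4)
    (E := [(0, 1), (0, 2), (1, 3), (1, 4), (2, 5), (2, 6)])
    (by simp [hadj]) [[0, 1, 2, 3, 2, 3]] (by decide +kernel)
  have h2 := four_le_cfc_of_isAcyclic hG ha (x₁ := φ.symm 3) (x₂ := φ.symm 4) (a := φ.symm 1)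
    (m := φ.symm 0) (b := φ.symm 2) (y₁ := φ.symm 5) (y₂ := φ.symm 6) (nodup_seven.2 (by simp))
    (hadj _ _ (by decide)) (hadj _ _ (by decide)) (hadj _ _ (by decide)) (hadj _ _ (by decide))
    (hadj _ _ (by decide)) (hadj _ _ (by decide))
  rw [hc] at h1
  omega

/-- A connected graph of order five with a cycle that is not complete satisfies `cfc G = 2`. -/
lemma cfc_eq_two_of_not_isAcyclic [Fintype V] (hG : G.Connected) (hn : Fintype.card V = 5)
    (ha : ¬ G.IsAcyclic) (ht : G ≠ ⊤) : cfc G = 2 := by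
  have h1 := cfc_add_three_le_of_not_isAcyclic hG hn.ge ha
  have h2 : ¬ cfc G ≤ 1 := fun h ↦ ht (eq_top_of_cfc_le_one hG h)
  omega

/-- On five vertices a tree has four edges and the complete graph ten, so the edge count rules out
both. -/
lemma cfc_eq_two_of_iso [Fintype V] (hG : G.Connected) {H : SimpleGraph (Fin 5)} (φ : G ≃g H)
    {E : Finset (Sym2 (Fin 5))} (hH : H.edgeSet = E) (hE : 5 ≤ E.card) (hE' : E.card < 10) :
    cfc G = 2 := by
  classical
  have hc : Fintype.card V = 5 := by simpa using Fintype.card_congr φ.toEquiv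
  have hcard : G.edgeFinset.card = E.card := by
    rw [φ.card_edgeFinset_eq]
    exact congrArg _ (Finset.coe_injective (by rw [coe_edgeFinset, hH]))
  refine cfc_eq_two_of_not_isAcyclic hG hc (fun ha ↦ ?_) ?_
  · have := (⟨hG, ha⟩ : G.IsTree).card_edgeFinset
    omega
  · rintro rfl
    have := card_edgeFinset_top_eq_card_choose_two (V := V)
    rw [hc, show Nat.choose 5 2 = 10 from rfl] at this
    rw [← this] at hE'
    refine hE'.ne (hcard.symm.trans ?_)
    congr
    exact Subsingleton.elim _ _

lemma IsBridgedOrderFive.cfc_eq [Fintype V] (hG : G.Connected) (hn : Fintype.card V = 5)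
    (h : IsBridgedOrderFive G) : cfc G = 2 := by
  rcases h with h | h | ⟨⟨φ⟩⟩ | ⟨⟨φ⟩⟩ | ⟨⟨φ⟩⟩ | ⟨⟨φ⟩⟩ | ⟨⟨φ⟩⟩
  · simpa [hn] using h.cfc_eq hG hn.ge
  · simpa [hn] using h.cfc_eq hG hn.ge
  · refine cfc_eq_two_of_iso hG φ
      (E := {s(0, 1), s(1, 2), s(0, 2), s(0, 3), s(1, 4)}) ?_ (by decide) (by decide)
    rw [← edgeSet_fromEdgeSet_of_finset (by decide)]
    simp [bull]
  · refine cfc_eq_two_of_iso hG φ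
      (E := {s(0, 1), s(1, 2), s(2, 3), s(0, 3), s(0, 4)}) ?_ (by decide) (by decide)
    rw [← edgeSet_fromEdgeSet_of_finset (by decide)]
    simp [cyclePendant]
  · refine cfc_eq_two_of_iso hG φ
      (E := {s(0, 1), s(1, 2), s(2, 3), s(0, 3), s(0, 2), s(0, 4)}) ?_ (by decide) (by decide)
    rw [← edgeSet_fromEdgeSet_of_finset (by decide)]
    simp [diamondPendantThree]
  · refine cfc_eq_two_of_iso hG φ
      (E := {s(0, 1), s(1, 2), s(2, 3), s(0, 3), s(1, 3), s(0, 4)}) ?_ (by decide) (by decide)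
    rw [← edgeSet_fromEdgeSet_of_finset (by decide)]
    simp [diamondPendantTwo]
  · refine cfc_eq_two_of_iso hG φ
      (E := {s(0, 1), s(1, 2), s(2, 3), s(0, 3), s(0, 2), s(1, 3), s(0, 4)}) ?_ (by decide) (by decide)
    rw [← edgeSet_fromEdgeSet_of_finset (by decide)]
    simp [completePendant]

lemma cfc_eq_of_degree [Fintype V] [DecidableRel G.Adj]
    (hG : G.IsTree) (hn : 6 ≤ Fintype.card V) (h : G.maxDegree = Fintype.card V - 3) :
    cfc G = Fintype.card V - 3 := by
  have := hG.connected.nonempty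
  obtain ⟨w, hw⟩ := G.exists_maximal_degree_vertex
  have h1 := degree_le_cfc_of_isAcyclic hG.connected hG.isAcyclic w
  have h2 := cfc_add_three_le_of_degree hG.connected (w := w) (by omega) (by omega)
  omega

/-- A tree of order at least five with `cfc G = n - 3` has maximum degree `n - 3`, or is `P_6` or
the forked tree. -/
lemma maxDegree_eq_or_nonempty_iso [Fintype V] [DecidableRel G.Adj] (hG : G.IsTree) (hn : 5 ≤ Fintype.card V)
    (h : cfc G = Fintype.card V - 3) :
    (6 ≤ Fintype.card V ∧ G.maxDegree = Fintype.card V - 3) ∨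
      Nonempty (G ≃g pathGraph 6) ∨ Nonempty (G ≃g forkedTree) := by
  have := hG.connected.nonempty
  obtain ⟨w, hw⟩ := G.exists_maximal_degree_vertex
  have hle (v : V) : G.degree v ≤ G.degree w := hw ▸ G.degree_le_maxDegree v
  have h1 := degree_le_cfc_of_isAcyclic hG.connected hG.isAcyclic w
  rcases (by omega : G.degree w ≤ 2 ∨ 3 ≤ G.degree w) with hd | hd
  · have h3 := three_le_cfc_of_degree_le_two hG.connected hG.isAcyclic (fun v ↦ (hle v).trans hd) hn
    rcases (by omega : Fintype.card V = 6 ∨ 7 ≤ Fintype.card V) with h6 | h7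
    · exact Or.inr (Or.inl (nonempty_iso_pathGraph_six hG (fun v ↦ (hle v).trans hd) h6))
    · have := cfc_add_four_le_of_degree_le_two hG.connected (fun v ↦ (hle v).trans hd) h7
      omega
  · rcases (by omega : G.degree w = Fintype.card V - 3 ∨ G.degree w + 4 ≤ Fintype.card V) with h' | h'
    · exact Or.inl ⟨by omega, hw.trans h'⟩
    · rcases cfc_add_four_le_or_nonempty_iso_forkedTree hG hle hd h' with h4 | h4
      · omega
      · exact Or.inr (Or.inr h4)

end CFC

/-! ### The classification -/

theorem theorem4p6 {V : Type*} [Fintype V] (G : SimpleGraph V) [DecidableRel G.Adj]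
    (hG : G.Connected) (hn : 4 ≤ Fintype.card V) :
    CFC.cfc G = Fintype.card V - 3 ↔
      (6 ≤ Fintype.card V ∧ G.IsTree ∧ G.maxDegree = Fintype.card V - 3) ∨
      (5 ≤ Fintype.card V ∧ CFC.IsStarAddEdge G) ∨
      (5 ≤ Fintype.card V ∧ CFC.IsU G) ∨
      (Fintype.card V = 5 ∧ G.IsEdgeConnected 2 ∧ G ≠ ⊤) ∨
      (Nonempty (G ≃g (⊤ : SimpleGraph (Fin 4))) ∨
        Nonempty (G ≃g SimpleGraph.pathGraph 6) ∨
        Nonempty (G ≃g CFC.bull) ∨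
        Nonempty (G ≃g CFC.cyclePendant) ∨
        Nonempty (G ≃g CFC.diamondPendantThree) ∨
        Nonempty (G ≃g CFC.diamondPendantTwo) ∨
        Nonempty (G ≃g CFC.completePendant) ∨
        Nonempty (G ≃g CFC.forkedTree)) := by
  constructor
  · intro h
    rcases hn.eq_or_lt with h4 | h5
    · obtain rfl := CFC.eq_top_of_cfc_le_one hG (by omega)
      refine Or.inr (Or.inr (Or.inr (Or.inr (Or.inl ⟨?_⟩))))
      exact SimpleGraph.Iso.completeGraph (Fintype.equivFinOfCardEq h4.symm)
    by_cases ha : G.IsAcyclic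
    · rcases CFC.maxDegree_eq_or_nonempty_iso ⟨hG, ha⟩ h5 h with ⟨h6, hd⟩ | hi | hi
      · exact Or.inl ⟨h6, ⟨hG, ha⟩, hd⟩
      · tauto
      · tauto
    rcases (by omega : Fintype.card V = 5 ∨ 6 ≤ Fintype.card V) with hc | hc
    · by_cases hb : G.IsEdgeConnected 2
      · refine Or.inr (Or.inr (Or.inr (Or.inl ⟨hc, hb, ?_⟩)))
        rintro rfl
        have := CFC.cfc_top_le (V := V)
        omega
      · have := CFC.isBridgedOrderFive hG hc ha hb
        unfold CFC.IsBridgedOrderFive at this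
        have h5' : 5 ≤ Fintype.card V := h5
        tauto
    · rcases CFC.isStarAddEdge_or_isU hG hc ha (by omega) with h' | h'
      · exact Or.inr (Or.inl ⟨h5, h'⟩)
      · exact Or.inr (Or.inr (Or.inl ⟨h5, h'⟩))
  · have hfive (h : CFC.IsBridgedOrderFive G) (hc : Fintype.card V = 5) :
        CFC.cfc G = Fintype.card V - 3 := by
      rw [h.cfc_eq hG hc, hc]
    have hcard {m : ℕ} {H : SimpleGraph (Fin m)} (φ : G ≃g H) : Fintype.card V = m := by
      simpa using Fintype.card_congr φ.toEquiv
    rintro (⟨h6, ht, hd⟩ | ⟨h5, h⟩ | ⟨h5, h⟩ | ⟨hc, hb, htop⟩ | ⟨⟨φ⟩⟩ | ⟨⟨φ⟩⟩ | ⟨⟨φ⟩⟩ | ⟨⟨φ⟩⟩ | ⟨⟨φ⟩⟩ |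
      ⟨⟨φ⟩⟩ | ⟨⟨φ⟩⟩ | ⟨⟨φ⟩⟩)
    · exact CFC.cfc_eq_of_degree ht h6 hd
    · exact h.cfc_eq hG h5
    · exact h.cfc_eq hG h5
    -- Were `G` acyclic, any edge would be a bridge, contradicting 2-edge-connectedness.
    · rw [CFC.cfc_eq_two_of_not_isAcyclic hG hc (fun ha ↦ ?_) htop, hc]
      have : Nontrivial V := Fintype.one_lt_card_iff_nontrivial.1 (by omega)
      obtain ⟨v⟩ := hG.nonempty
      obtain ⟨w, hvw⟩ := hG.preconnected.exists_adj_of_nontrivial v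
      exact (SimpleGraph.isAcyclic_iff_forall_adj_isBridge.1 ha hvw).not_isEdgeReachable_two
        (hb v w)
    · have hc := hcard φ
      have htop : G = ⊤ := by
        ext v w
        rw [← φ.map_adj_iff]
        simp
      have h1 : CFC.cfc G ≤ 1 := by rw [htop]; exact CFC.cfc_top_le
      have h2 := CFC.cfc_pos hG (by omega)
      omega
    · rw [CFC.cfc_eq_three_of_iso_pathGraph_six hG φ, hcard φ]
    · exact hfive (Or.inr (Or.inr (Or.inl ⟨φ⟩))) (hcard φ)
    · exact hfive (Or.inr (Or.inr (Or.inr (Or.inl ⟨φ⟩)))) (hcard φ)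
    · exact hfive (Or.inr (Or.inr (Or.inr (Or.inr (Or.inl ⟨φ⟩))))) (hcard φ)
    · exact hfive (Or.inr (Or.inr (Or.inr (Or.inr (Or.inr (Or.inl ⟨φ⟩)))))) (hcard φ)
    · exact hfive (Or.inr (Or.inr (Or.inr (Or.inr (Or.inr (Or.inr ⟨φ⟩)))))) (hcard φ)
    · rw [CFC.cfc_eq_four_of_iso_forkedTree hG φ, hcard φ]
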